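/- Let $m\ge 3$ and let $\mathcal C$ be a unitary fusion category of lines $L_{n,1}$ of the minimal model $M_m$: its simple objects are, up to isomorphism, $1,\dots,m-1$ (with $n$ standing for $L_{n,1}$, and $1$ the unit), with the minimal model fusion rules $$a\otimes b=\bigoplus_{c}c,\qquad |a-b|+1\le c\le\min(a+b-1,\,2m-1-a-b),\quad c+a+b\ \text{odd}.$$ Consider any relativistic quantum field theory on $\mathbb R$ with symmetry $\mathcal C$ whose boundary conditions at $\pm\infty$ form the regular module category of $\mathcal C$ (for instance $M_m$ deformed by $-\lambda\int\phi_{1,3}$, $\lambda>0$, under this assumption). That is, there are Hilbert spaces $\mathcal H_{a,b}$ ($1\le a,b\le m-1$) carrying strongly continuous unitary positive-energy representations of the connected Poincaré group of $\mathbb R^{1,1}$, and every line $Y\in\mathcal C$ stretched between topological junctions on the left boundary (from $a$ to $c$, an element of $\mathrm{Hom}(c,Y\otimes a)\cong\mathrm{Hom}(\bar Y\otimes c,a)$) and on the right boundary (from $b$ to $d$, an element of $\mathrm{Hom}(Y\otimes b,d)$) gives a bounded Poincaré-equivariant operator $\mathcal H_{a,b}\to\mathcal H_{c,d}$, bilinear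 in the junctions. Topological local operators may be slid along the line to either end, the identity line acts as the identity, and stacked lines compose. Choose basis junctions $a\otimes b\to c$, canonical when $a$ or $b$ is the identity and for $n\otimes n\to 1$ (the dual of a normalized solution of the duality equations, with closed loop equal to the quantum dimension $d_n$). Such choices exist, and each determines unique $F$-symbols and inverse $F$-symbols. Call a pair $(n,s)$ of labels in $\{1,\dots,m-1\}$ *allowed* if $s=n\pm1$; thus either $(n,s)=(1,2)$, or $2\le n\le m-2$ with either sign, or $n=m-1$ with the minus sign. Let $L_{1,2}^{n,s}:\mathcal H_{1,2}\to\mathcal H_{n,s}$ and $L_{n,s}^{1,2}:\mathcal H_{n,s}\to\mathcal H_{1,2}$ be the operators of the line $n$ with the chosen junctions. Then: 1. For every allowed $(n,s)$, $$L_{n,s}^{1,2}\circ L_{1,2}^{n,s}=\big[(F^{1}_{n,n,1})^{-1}_{1,n}\,(F^{2}_{n,n,2})^{-1}_{1,s}\,d_n\big]\,\mathrm{Id}_{\mathcal H_{1,2}},$$ where both inverse $F$-symbols are nonzero and $d_n>0$. Hence $L_{1,2}^{n,s}$ is injective and $L_{n,s}^{1,2}$ is surjective. Moreover $L_{1,2}^{1,2}=\mathrm{Id}$.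 2. Every operator $\mathcal H_{1,2}\to\mathcal H_{r,s}$ given by a line of $\mathcal C$ with boundary junctions is a multiple of $L_{1,2}^{r,s}$ if $(r,s)$ is allowed, and is $0$ otherwise. 3. There are exactly $2(m-2)$ allowed pairs. Let $K\subset\mathcal H_{1,2}$ be the space of states of a single particle (soliton) of mass $\mu>0$, i.e. a nonzero closed subspace which is an irreducible representation of the Poincaré group on which $H^2-P^2=\mu^2$. Then for every allowed $(n,s)$ the image $L_{1,2}^{n,s}(K)\subset\mathcal H_{n,s}$ is again the space of states of a single particle of mass $\mu$. Any nonzero $\psi\in K$ lies in a multiplet of $2(m-2)$ nonzero states $L_{1,2}^{n,s}\psi$ of mass $\mu$, one in each sector $\mathcal H_{n,s}$ with $(n,s)$ allowed, which are linearly independent in $\bigoplus_{a,b}\mathcal H_{a,b}$. 4. For $m=4$, write $N=2$ and $\eta=3$. The fusion rules are those of the $\mathbb Z_2$ Tambara–Yamagami category, $\eta\otimes\eta=1$, $\eta\otimes N=N\otimes\eta=N$, $N\otimes N=1\oplus\eta$, and the multiplet is four-fold, in the sectors $\mathcal H_{1,N},\mathcal H_{N,1},\mathcal H_{N,\eta},\mathcal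 H_{\eta,N}$. -/

import Mathlib

open CategoryTheory MonoidalCategory
open scoped ContDiff

universe u v w

/-! ## Unitary fusion categories -/

/-- A unitary (dagger) structure on a `ℂ`-linear monoidal category: an antilinear involution on
morphisms, identity on objects, positive definite, compatible with the tensor product, and for which
the structural isomorphisms are unitary. Composition is written diagrammatically (`f ≫ g`). -/
class UnitaryStructure (C : Type u) [Category.{v} C] [Preadditive C] [Linear ℂ C]
    [MonoidalCategory C] where
  dag : ∀ {X Y : C}, (X ⟶ Y) → (Y ⟶ X)
  dag_dag : ∀ {X Y : C} (f : X ⟶ Y), dag (dag f) = f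
  dag_id : ∀ X : C, dag (𝟙 X) = 𝟙 X
  dag_comp : ∀ {X Y Z : C} (f : X ⟶ Y) (g : Y ⟶ Z), dag (f ≫ g) = dag g ≫ dag f
  dag_add : ∀ {X Y : C} (f g : X ⟶ Y), dag (f + g) = dag f + dag g
  dag_smul : ∀ {X Y : C} (c : ℂ) (f : X ⟶ Y), dag (c • f) = (starRingEnd ℂ c) • dag f
  dag_eq_zero : ∀ {X Y : C} (f : X ⟶ Y), f ≫ dag f = 0 → f = 0
  dag_pos : ∀ {X Y : C} (f : X ⟶ Y), ∃ g : X ⟶ X, f ≫ dag f = g ≫ dag g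
  dag_tensor : ∀ {X Y X' Y' : C} (f : X ⟶ Y) (g : X' ⟶ Y'),
    dag (f ⊗ₘ g) = dag f ⊗ₘ dag g
  dag_associator : ∀ X Y Z : C, dag (α_ X Y Z).hom = (α_ X Y Z).inv
  dag_leftUnitor : ∀ X : C, dag (λ_ X).hom = (λ_ X).inv
  dag_rightUnitor : ∀ X : C, dag (ρ_ X).hom = (ρ_ X).inv

/-- The finiteness and semisimplicity conditions which make a rigid `ℂ`-linear abelian monoidal
category a fusion category. -/
structure IsFusionCategory (C : Type u) [Category.{v} C] [Abelian C] [Linear ℂ C]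
    [MonoidalCategory C] : Prop where
  finite_hom : ∀ X Y : C, FiniteDimensional ℂ (X ⟶ Y)
  simple_unit : Simple (𝟙_ C)
  semisimple : ∀ Y : C, ∃ (k : ℕ) (S : Fin k → C) (b : Limits.Bicone S),
    (∀ i, Simple (S i)) ∧ Nonempty b.IsBilimit ∧ Nonempty (b.pt ≅ Y)
  finite_simples : ∃ (k : ℕ) (S : Fin k → C), ∀ Y : C, Simple Y → ∃ i, Nonempty (Y ≅ S i)

/-! ## The lines `L_{n,1}` of the minimal model `M_m` -/

/-- The fusion rule of the diagonal minimal model `M_m`: the term `L_{k,l}` occurs in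
`L_{r,s} ⊗ L_{ρ,σ}`, i.e. `|ρ - r| + 1 ≤ k ≤ min (ρ + r - 1) (2m - 1 - ρ - r)` with `k - ρ + r - 1`
even, and `|σ - s| + 1 ≤ l ≤ min (σ + s - 1) (2m + 1 - σ - s)` with `l - σ + s - 1` even. -/
def KacRule (m : ℕ) (x y z : ℕ × ℕ) : Prop :=
  (x.1 < z.1 + y.1 ∧ y.1 < z.1 + x.1 ∧ z.1 < x.1 + y.1 ∧ z.1 + x.1 + y.1 < 2 * m ∧
    Odd (z.1 + x.1 + y.1)) ∧
  (x.2 < z.2 + y.2 ∧ y.2 < z.2 + x.2 ∧ z.2 < x.2 + y.2 ∧ z.2 + x.2 + y.2 < 2 * (m + 1) ∧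
    Odd (z.2 + x.2 + y.2))

/-- The labels `n = 1, …, m - 1` of the lines `L_{n,1}`. -/
abbrev Row (m : ℕ) : Type := {n : ℕ // 1 ≤ n ∧ n < m}

/-- The label `1` (the identity line). -/
def Row.one {m : ℕ} (hm : 3 ≤ m) : Row m := ⟨1, by omega, by omega⟩

/-- The label `2`. -/
def Row.two {m : ℕ} (hm : 3 ≤ m) : Row m := ⟨2, by omega, by omega⟩

/-- `L_{c,1}` occurs in `L_{a,1} ⊗ L_{b,1}`. -/
def Row.Fuses {m : ℕ} (a b c : Row m) : Prop := KacRule m (a.1, 1) (b.1, 1) (c.1, 1)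

/-- The ordered pairs `(n, n ± 1)` of labels. -/
def Row.Adj {m : ℕ} (n s : Row m) : Prop := s.1 = n.1 + 1 ∨ s.1 + 1 = n.1

open Classical in
/-- A realization of the unitary fusion category `C` as the category of the lines `L_{n,1}` of
`M_m`: its simple objects are, up to isomorphism and without repetition, `X n` for `1 ≤ n ≤ m - 1`,
`X 1` is the (unitarily identified) unit, and they fuse by the minimal model fusion rules. -/
structure VerlindeLines (m : ℕ) (hm : 3 ≤ m) (C : Type u) [Category.{v} C] [Abelian C]
    [Linear ℂ C] [MonoidalCategory C] [UnitaryStructure C] where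
  X : Row m → C
  simple : ∀ n, Simple (X n)
  distinct : ∀ n n', Nonempty (X n ≅ X n') → n = n'
  exhaust : ∀ Y : C, Simple Y → ∃ n, Nonempty (Y ≅ X n)
  fusion : ∀ a b c, Module.finrank ℂ (X a ⊗ X b ⟶ X c) = if Row.Fuses a b c then 1 else 0
  unit : X (Row.one hm) ≅ 𝟙_ C
  unit_unitary : UnitaryStructure.dag unit.hom = unit.inv

section Junctions

variable {m : ℕ} {hm : 3 ≤ m} {C : Type u} [Category.{v} C] [Abelian C] [Linear ℂ C]
  [MonoidalCategory C] [UnitaryStructure C]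

/-- A choice of basis vectors `j a b c` of the (at most one-dimensional) junction spaces
`Hom(a ⊗ b, c)`, canonical for junctions with the identity line and for the fusion of a line with
its dual into the identity. The lines are self-dual; `cup a : 𝟙 ⟶ ā ⊗ a` and
`cup' a : 𝟙 ⟶ a ⊗ ā` (with `ā = a`; they differ by the Frobenius-Schur sign) are the normalized
solutions of the duality (zigzag) equations, and `dim a` is the value of the closed loop, i.e. the
quantum dimension. -/
structure Junctions (V : VerlindeLines m hm C) where
  j : ∀ a b c : Row m, V.X a ⊗ V.X b ⟶ V.X c
  cup : ∀ a, 𝟙_ C ⟶ V.X a ⊗ V.X a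
  cup' : ∀ a, 𝟙_ C ⟶ V.X a ⊗ V.X a
  dim : Row m → ℝ
  j_ne_zero : ∀ a b c, Row.Fuses a b c → j a b c ≠ 0
  j_one_left : ∀ b, j (Row.one hm) b b = V.unit.hom ▷ V.X b ≫ (λ_ (V.X b)).hom
  j_one_right : ∀ a, j a (Row.one hm) a = V.X a ◁ V.unit.hom ≫ (ρ_ (V.X a)).hom
  j_dual : ∀ a, j a a (Row.one hm) = UnitaryStructure.dag (cup a) ≫ V.unit.inv
  zigzag : ∀ a, (λ_ (V.X a)).inv ≫ cup' a ▷ V.X a ≫ (α_ _ _ _).hom ≫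
    V.X a ◁ UnitaryStructure.dag (cup a) ≫ (ρ_ (V.X a)).hom = 𝟙 (V.X a)
  zigzag' : ∀ a, (λ_ (V.X a)).inv ≫ cup a ▷ V.X a ≫ (α_ _ _ _).hom ≫
    V.X a ◁ UnitaryStructure.dag (cup' a) ≫ (ρ_ (V.X a)).hom = 𝟙 (V.X a)
  loop : ∀ a, cup a ≫ UnitaryStructure.dag (cup a) = (dim a : ℂ) • 𝟙 (𝟙_ C)
  loop' : ∀ a, cup' a ≫ UnitaryStructure.dag (cup' a) = (dim a : ℂ) • 𝟙 (𝟙_ C)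

variable {V : VerlindeLines m hm C}

/-- The fusion tree `(a ⊗ b) ⊗ c ⟶ e ⊗ c ⟶ d`. -/
def Junctions.treeL (J : Junctions V) (a b c d e : Row m) :
    (V.X a ⊗ V.X b) ⊗ V.X c ⟶ V.X d :=
  J.j a b e ▷ V.X c ≫ J.j e c d

/-- The fusion tree `(a ⊗ b) ⊗ c ≅ a ⊗ (b ⊗ c) ⟶ a ⊗ f ⟶ d`. -/
def Junctions.treeR (J : Junctions V) (a b c d f : Row m) :
    (V.X a ⊗ V.X b) ⊗ V.X c ⟶ V.X d :=
  (α_ _ _ _).hom ≫ V.X a ◁ J.j b c f ≫ J.j a f d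

/-- `F a b c d e f` is the `F`-symbol `F_{a,b,c}^{d;e,f}` in the junction basis `J`, and
`Finv a b c d e f` is the entry in the channels `e, f` of the inverse matrix of `F_{a,b,c}^d`,
the channels being restricted to the admissible ones. -/
structure Junctions.IsFSymbol [DecidableEq (Row m)] (J : Junctions V)
    (F Finv : Row m → Row m → Row m → Row m → Row m → Row m → ℂ) : Prop where
  move : ∀ a b c d e, Row.Fuses a b e → Row.Fuses e c d →
    J.treeL a b c d e = ∑ᶠ f, F a b c d e f • J.treeR a b c d f
  support : ∀ a b c d e f,
    ¬ (Row.Fuses a b e ∧ Row.Fuses e c d ∧ Row.Fuses b c f ∧ Row.Fuses a f d) →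
    F a b c d e f = 0 ∧ Finv a b c d e f = 0
  inv_right : ∀ a b c d e e', Row.Fuses a b e → Row.Fuses e c d → Row.Fuses a b e' →
    Row.Fuses e' c d →
    ∑ᶠ f, F a b c d e f * Finv a b c d e' f = if e = e' then 1 else 0
  inv_left : ∀ a b c d f f', Row.Fuses b c f → Row.Fuses a f d → Row.Fuses b c f' →
    Row.Fuses a f' d →
    ∑ᶠ e, Finv a b c d e f * F a b c d e f' = if f = f' then 1 else 0

end Junctions

/-- Rotation of a junction `φ : ā ⊗ N ⟶ M` into `N ⟶ a ⊗ M`, by means of `𝟙 ⟶ a ⊗ ā`. -/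
def bend {C : Type u} [Category.{v} C] [MonoidalCategory C] {a a' M N : C}
    (coev : 𝟙_ C ⟶ a ⊗ a') (φ : a' ⊗ N ⟶ M) : N ⟶ a ⊗ M :=
  (λ_ N).inv ≫ coev ▷ N ≫ (α_ a a' N).hom ≫ a ◁ φ

/-! ## Relativistic sectors and particles in `1 + 1` dimensions -/

/-- A strongly continuous unitary representation of the connected Poincaré group of
`(1+1)`-dimensional Minkowski space on `E`, with non-negative energy. A point of spacetime is a
pair `(t, x)`, and `trans (t, 0) = exp (-i t H)`, so `φ = H ψ` in the last field. -/
structure PoincareRep (E : Type w) [NormedAddCommGroup E] [InnerProductSpace ℂ E] where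
  trans : ℝ × ℝ → (E ≃ₗᵢ[ℂ] E)
  boost : ℝ → (E ≃ₗᵢ[ℂ] E)
  trans_add : ∀ p q ψ, trans (p + q) ψ = trans p (trans q ψ)
  boost_add : ∀ θ η ψ, boost (θ + η) ψ = boost θ (boost η ψ)
  boost_trans : ∀ θ t x ψ, boost θ (trans (t, x) ψ) =
    trans (Real.cosh θ * t + Real.sinh θ * x, Real.sinh θ * t + Real.cosh θ * x) (boost θ ψ)
  continuous_trans : ∀ ψ, Continuous fun p => trans p ψ
  continuous_boost : ∀ ψ, Continuous fun θ => boost θ ψ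
  energy_nonneg : ∀ ψ φ : E, HasDerivAt (fun t : ℝ => trans (t, 0) ψ) (-Complex.I • φ) 0 →
    0 ≤ (inner ℂ ψ φ).re

/-- The Klein-Gordon operator `∂_t² - ∂_x² + μ²`. -/
noncomputable def kleinGordon (μ : ℝ) (f : ℝ × ℝ → ℝ) (p : ℝ × ℝ) : ℝ :=
  iteratedDeriv 2 (fun t => f (t, p.2)) p.1 - iteratedDeriv 2 (fun x => f (p.1, x)) p.2
    + μ ^ 2 * f p

section Particles

variable {E : Type w} [NormedAddCommGroup E] [InnerProductSpace ℂ E]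

/-- `ψ` is a (normalizable) state of mass `μ`, `(H² - P²) ψ = μ² ψ`: its spacetime translates
satisfy the Klein-Gordon equation of mass `μ` in the sense of distributions. -/
def PoincareRep.HasMass [CompleteSpace E] (U : PoincareRep E) (μ : ℝ) (ψ : E) : Prop :=
  ∀ f : ℝ × ℝ → ℝ, ContDiff ℝ ∞ f → HasCompactSupport f →
    ∫ p : ℝ × ℝ, ((kleinGordon μ f p : ℝ) : ℂ) • U.trans p ψ = 0

/-- `K` is stable under the Poincaré group. -/
def PoincareRep.Invariant (U : PoincareRep E) (K : Submodule ℂ E) : Prop :=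
  (∀ p, ∀ ψ ∈ K, U.trans p ψ ∈ K) ∧ (∀ θ, ∀ ψ ∈ K, U.boost θ ψ ∈ K)

/-- `K` is the space of states of a single particle of mass `μ > 0`: a closed subspace which is an
irreducible representation of the Poincaré group of mass `μ`. -/
structure PoincareRep.IsParticle [CompleteSpace E] (U : PoincareRep E) (μ : ℝ) (K : Submodule ℂ E) : Prop where
  mass_pos : 0 < μ
  closed : IsClosed (K : Set E)
  invariant : U.Invariant K
  ne_bot : K ≠ ⊥
  irreducible : ∀ K' : Submodule ℂ E, IsClosed (K' : Set E) → U.Invariant K' → K' ≤ K →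
    K' = ⊥ ∨ K' = K
  mass : ∀ ψ ∈ K, U.HasMass μ ψ

end Particles

/-! ## Symmetric theories with the regular module category of boundary conditions -/

section Theory

variable {m : ℕ} {hm : 3 ≤ m} {C : Type u} [Category.{v} C] [Abelian C] [Linear ℂ C]
  [MonoidalCategory C] [MonoidalPreadditive C] [MonoidalLinear ℂ C] [UnitaryStructure C]

/-- The sectors of a relativistic quantum field theory on the line with symmetry category `C`, whose
boundary conditions at `± ∞` form the regular module category: the simple boundary conditions are
labelled by the simple lines, and the junction space of a line `Y` taking the boundary `a` to the
boundary `b` is `Hom(Y ⊗ a, b)`.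

`H a b` is the Hilbert space with boundary conditions `a` on the left and `b` on the right.
`line Y l g` is the operator of a topological line `Y` (not necessarily simple) stretched from a
junction `l` on the left boundary, below which the boundary is `a` and above which it is `c`, to a
junction `g` on the right boundary, below which it is `b` and above which it is `d`. Time runs
upwards, and boundaries are oriented so that the empty theory is on their right: upwards on the right
boundary, where `g : Y ⊗ b ⟶ d` absorbs `Y`, and downwards on the left boundary, where
`l : c ⟶ Y ⊗ a` emits `Y` (equivalently, by `bend`, a junction `Ȳ ⊗ c ⟶ a`). The operator is bilinear
in the junctions (`line`), a topological local operator `f` on the line may be moved to either end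
(`line_slide`), the identity line is transparent (`line_unit`), two lines on top of each other are
the composition (`line_comp`), and, being topological, it commutes with the spacetime symmetries. -/
structure SymmetricTheory (V : VerlindeLines m hm C) where
  H : Row m → Row m → Type w
  [normed : ∀ a b, NormedAddCommGroup (H a b)]
  [inner : ∀ a b, InnerProductSpace ℂ (H a b)]
  [complete : ∀ a b, CompleteSpace (H a b)]
  U : ∀ a b, PoincareRep (H a b)
  line : ∀ {a b c d : Row m} (Y : C),
    (V.X c ⟶ Y ⊗ V.X a) →ₗ[ℂ] (Y ⊗ V.X b ⟶ V.X d) →ₗ[ℂ] (H a b →L[ℂ] H c d)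
  line_slide : ∀ {a b c d : Row m} {Y Z : C} (f : Y ⟶ Z) (l : V.X c ⟶ Y ⊗ V.X a)
    (g : Z ⊗ V.X b ⟶ V.X d), line Y l (f ▷ V.X b ≫ g) = line Z (l ≫ f ▷ V.X a) g
  line_unit : ∀ a b : Row m,
    line (𝟙_ C) (λ_ (V.X a)).inv (λ_ (V.X b)).hom = ContinuousLinearMap.id ℂ (H a b)
  line_comp : ∀ {a b c d p q : Row m} (Y Z : C) (l : V.X c ⟶ Y ⊗ V.X a)
    (g : Y ⊗ V.X b ⟶ V.X d) (l' : V.X p ⟶ Z ⊗ V.X c) (g' : Z ⊗ V.X d ⟶ V.X q),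
    (line Z l' g').comp (line Y l g) =
      line (Z ⊗ Y) (l' ≫ Z ◁ l ≫ (α_ Z Y (V.X a)).inv) ((α_ Z Y (V.X b)).hom ≫ Z ◁ g ≫ g')
  line_trans : ∀ {a b c d : Row m} (Y : C) (l : V.X c ⟶ Y ⊗ V.X a) (g : Y ⊗ V.X b ⟶ V.X d)
    (x : ℝ × ℝ) (ψ : H a b), line Y l g ((U a b).trans x ψ) = (U c d).trans x (line Y l g ψ)
  line_boost : ∀ {a b c d : Row m} (Y : C) (l : V.X c ⟶ Y ⊗ V.X a) (g : Y ⊗ V.X b ⟶ V.X d)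
    (θ : ℝ) (ψ : H a b), line Y l g ((U a b).boost θ ψ) = (U c d).boost θ (line Y l g ψ)

attribute [instance] SymmetricTheory.normed SymmetricTheory.inner SymmetricTheory.complete

variable {V : VerlindeLines m hm C}

/-- The total Hilbert space, the direct sum of all sectors. -/
abbrev SymmetricTheory.Total (T : SymmetricTheory.{u, v, w} V) : Type w :=
  PiLp 2 fun p : Row m × Row m => T.H p.1 p.2

/-- The map `L_{1,2}^{n,s}` from `H_{1,2}` to `H_{n,s}` given by the line `n`, with the junctions
`n̄ ⊗ n ⟶ 1` on the left boundary and `n ⊗ 2 ⟶ s` on the right boundary. -/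
def SymmetricTheory.up (T : SymmetricTheory.{u, v, w} V) (J : Junctions V) (n s : Row m) :
    T.H (Row.one hm) (Row.two hm) →L[ℂ] T.H n s :=
  T.line (V.X n) (bend (J.cup' n) (J.j n n (Row.one hm))) (J.j n (Row.two hm) s)

/-- The reverse map `L_{n,s}^{1,2}` from `H_{n,s}` to `H_{1,2}` given by the line `n̄`, with the
junctions `n ⊗ 1 ⟶ n` on the left boundary and `n̄ ⊗ s ⟶ 2` on the right boundary. -/
def SymmetricTheory.down (T : SymmetricTheory.{u, v, w} V) (J : Junctions V) (n s : Row m) :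
    T.H n s →L[ℂ] T.H (Row.one hm) (Row.two hm) :=
  T.line (V.X n) (bend (J.cup n) (J.j n (Row.one hm) n)) (J.j n s (Row.two hm))

end Theory

/-! ## Labels -/

/-! An operator out of `H 1 2` is a line `Y` with two junctions. Decomposing `Y` into simple lines
and sliding the projections along it reduces to `Y = e` simple. The left junction then lies in
`Hom(r, e ⊗ 1)`, which vanishes unless `e = r`. The right junction lies in `Hom(r ⊗ 2, s)`, which is
one-dimensional for `s = r ± 1` and zero otherwise. Every such operator is therefore a multiple of
`up` (`SymmetricTheory.exists_line_eq`).

The composite `down ∘ up` stacks two lines `n`. On the left, where the boundary is the identity, the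
junction of `up` is trivial (`Junctions.bend_up`), so the two left junctions together are just the
cup creating `n ⊗ n`. On the right they form a `treeR`, which the inverse `F`-move turns into a sum
over channels `e` in which the two lines fuse first. The vertex `n ⊗ n ⟶ e` slides to the left end
and meets the cup. By Schur's lemma this gives zero unless `e = 1`, where the closed loop
contributes the quantum dimension (`SymmetricTheory.down_comp_up`). The other inverse symbol in the
formula equals `1` for canonical junctions (`Junctions.IsFSymbol.inv_one`).

The resulting scalar is nonzero: its `F`-factor measures a composite of a bent, hence nonzero,
junction with a basis junction (`Junctions.IsFSymbol.inv_ne_zero`), and the loop is positive because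
the dagger is (`Junctions.dim_pos`). So `up` has a bounded left inverse, is bounded below and is
Poincaré-equivariant. It is thus a homeomorphism onto its image and carries particles to particles
of the same mass (`PoincareRep.IsParticle.map`).

Junction bases exist because the fusion rules force simple lines to be self-dual, and one suitably
rescaled vector gives both cups (`VerlindeLines.exists_cups`). The `F`-symbols exist uniquely
because the fusion trees of either bracketing form a basis (`Junctions.existsUnique_isFSymbol`). -/

noncomputable instance Row.instFintype (m : ℕ) : Fintype (Row m) :=
  have : Finite (Row m) := Set.Finite.to_subtype ((Set.finite_Iio m).subset fun _ h => h.2)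
  Fintype.ofFinite _

lemma Row.fuses_iff {m : ℕ} (a b c : Row m) : Row.Fuses a b c ↔
    a.1 < c.1 + b.1 ∧ b.1 < c.1 + a.1 ∧ c.1 < a.1 + b.1 ∧ c.1 + a.1 + b.1 < 2 * m ∧
      Odd (c.1 + a.1 + b.1) := by
  have h : Odd 3 := by decide
  simp only [Row.Fuses, KacRule]
  constructor
  · exact fun H => H.1
  -- The second Kac labels are all `1`. The bound `3 < 2 * (m + 1)` needs `1 ≤ m`, which follows
  -- from the last inequality in `H`.
  · exact fun H => ⟨H, by omega, by omega, by omega, by omega, h⟩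

lemma Row.fuses_one_right {m : ℕ} (hm : 3 ≤ m) (a b : Row m) :
    Row.Fuses a b (Row.one hm) ↔ a = b := by
  rw [Row.fuses_iff, Subtype.ext_iff]
  have ha := a.2
  have hb := b.2
  simp only [Row.one, Nat.odd_iff]
  omega

lemma Row.fuses_mid_one {m : ℕ} (hm : 3 ≤ m) (a b : Row m) :
    Row.Fuses a (Row.one hm) b ↔ a = b := by
  rw [Row.fuses_iff, Subtype.ext_iff]
  have ha := a.2
  have hb := b.2
  simp only [Row.one, Nat.odd_iff]
  omega

lemma Row.fuses_two {m : ℕ} (hm : 3 ≤ m) (n s : Row m) :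
    Row.Fuses n (Row.two hm) s ↔ Row.Adj n s := by
  rw [Row.fuses_iff]
  have hn := n.2
  have hs := s.2
  simp only [Row.two, Row.Adj, Nat.odd_iff]
  omega

lemma Row.fuses_to_two {m : ℕ} (hm : 3 ≤ m) (n s : Row m) :
    Row.Fuses n s (Row.two hm) ↔ Row.Adj n s := by
  rw [Row.fuses_iff]
  have hn := n.2
  have hs := s.2
  simp only [Row.two, Row.Adj, Nat.odd_iff]
  omega

/-! ## Dagger calculus -/

section Dagger

variable {C : Type u} [Category.{v} C] [Preadditive C] [Linear ℂ C] [MonoidalCategory C]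
  [UnitaryStructure C]

open UnitaryStructure

lemma dag_zero (X Y : C) : dag (0 : X ⟶ Y) = 0 := by
  simpa using dag_smul (0 : ℂ) (0 : X ⟶ Y)

lemma dag_ne_zero {X Y : C} {f : X ⟶ Y} (hf : f ≠ 0) : dag f ≠ 0 := by
  intro h
  apply hf
  rw [← dag_dag f, h, dag_zero]

lemma dag_comp_self_ne_zero {X Y : C} {f : X ⟶ Y} (hf : f ≠ 0) : dag f ≫ f ≠ 0 := by
  intro h
  refine dag_ne_zero hf (dag_eq_zero _ ?_)
  rwa [dag_dag]

lemma dag_whiskerRight {X Y : C} (f : X ⟶ Y) (Z : C) : dag (f ▷ Z) = dag f ▷ Z := by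
  rw [← tensorHom_id, dag_tensor, dag_id, tensorHom_id]

lemma dag_whiskerLeft {X Y : C} (Z : C) (f : X ⟶ Y) : dag (Z ◁ f) = Z ◁ dag f := by
  rw [← id_tensorHom, dag_tensor, dag_id, id_tensorHom]

lemma dag_leftUnitor_inv (X : C) : dag (λ_ X).inv = (λ_ X).hom := by
  rw [← dag_leftUnitor, dag_dag]

end Dagger

/-! ## Simple objects and semisimplicity -/

lemma IsFusionCategory.exists_smul_id_unit {C : Type u} [Category.{v} C] [Abelian C]
    [Linear ℂ C] [MonoidalCategory C] (hC : IsFusionCategory C) (f : 𝟙_ C ⟶ 𝟙_ C) :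
    ∃ x : ℂ, f = x • 𝟙 (𝟙_ C) := by
  have := hC.simple_unit
  have := hC.finite_hom (𝟙_ C) (𝟙_ C)
  obtain ⟨x, hx⟩ := endomorphism_simple_eq_smul_id ℂ f
  exact ⟨x, hx.symm⟩

section Simple

variable {m : ℕ} {hm : 3 ≤ m} {C : Type u} [Category.{v} C] [Abelian C] [Linear ℂ C]
  [MonoidalCategory C] [UnitaryStructure C]

lemma VerlindeLines.hom_eq_zero (V : VerlindeLines m hm C) {a b : Row m} (h : a ≠ b)
    (f : V.X a ⟶ V.X b) : f = 0 := by
  by_contra hf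
  have := V.simple a
  have := V.simple b
  have := isIso_of_hom_simple hf
  exact h (V.distinct _ _ ⟨asIso f⟩)

lemma VerlindeLines.exists_smul_id (V : VerlindeLines m hm C) (hC : IsFusionCategory C)
    {a : Row m} (f : V.X a ⟶ V.X a) : ∃ x : ℂ, f = x • 𝟙 (V.X a) := by
  have := V.simple a
  have := hC.finite_hom (V.X a) (V.X a)
  obtain ⟨x, hx⟩ := endomorphism_simple_eq_smul_id ℂ f
  exact ⟨x, hx.symm⟩

lemma VerlindeLines.id_ne_zero (V : VerlindeLines m hm C) (a : Row m) : 𝟙 (V.X a) ≠ 0 := by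
  have := V.simple a
  exact id_nonzero _

/-- Every object decomposes into simple lines. -/
lemma VerlindeLines.exists_resolution (V : VerlindeLines m hm C) (hC : IsFusionCategory C)
    (Y : C) : ∃ (k : ℕ) (e : Fin k → Row m) (π : ∀ i, Y ⟶ V.X (e i)) (ι : ∀ i, V.X (e i) ⟶ Y),
      ∑ i, π i ≫ ι i = 𝟙 Y := by
  obtain ⟨k, S, b, hS, ⟨hb⟩, ⟨φ⟩⟩ := hC.semisimple Y
  choose e he using fun i => V.exhaust (S i) (hS i)
  let ψ := fun i => (he i).some
  refine ⟨k, e, fun i => φ.inv ≫ b.π i ≫ (ψ i).hom, fun i => (ψ i).inv ≫ b.ι i ≫ φ.hom, ?_⟩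
  have h := Limits.IsBilimit.total hb
  calc _ = ∑ i, φ.inv ≫ (b.π i ≫ b.ι i) ≫ φ.hom := by simp
    _ = φ.inv ≫ (∑ i, b.π i ≫ b.ι i) ≫ φ.hom := by
      rw [Preadditive.sum_comp, Preadditive.comp_sum]
    _ = 𝟙 Y := by rw [h]; simp

lemma VerlindeLines.hom_tensor_eq_zero (V : VerlindeLines m hm C) (hC : IsFusionCategory C)
    {a b c : Row m} (h : ¬ Row.Fuses a b c) (f : V.X a ⊗ V.X b ⟶ V.X c) : f = 0 := by
  have := hC.finite_hom (V.X a ⊗ V.X b) (V.X c)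
  have h0 := V.fusion a b c
  rw [if_neg h] at h0
  have := Module.finrank_zero_iff.mp h0
  exact Subsingleton.elim _ _

lemma VerlindeLines.exists_hom_tensor_ne_zero (V : VerlindeLines m hm C) {a b c : Row m}
    (h : Row.Fuses a b c) : ∃ f : V.X a ⊗ V.X b ⟶ V.X c, f ≠ 0 := by
  have h0 := V.fusion a b c
  rw [if_pos h] at h0
  obtain ⟨f, hf, -⟩ := finrank_eq_one_iff'.mp h0
  exact ⟨f, hf⟩

lemma VerlindeLines.exists_eq_smul (V : VerlindeLines m hm C) (hC : IsFusionCategory C)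
    {a b c : Row m} {j : V.X a ⊗ V.X b ⟶ V.X c} (hj : Row.Fuses a b c → j ≠ 0)
    (f : V.X a ⊗ V.X b ⟶ V.X c) : ∃ x : ℂ, f = x • j := by
  by_cases h : Row.Fuses a b c
  · have h0 := V.fusion a b c
    rw [if_pos h] at h0
    obtain ⟨x, hx⟩ := (finrank_eq_one_iff_of_nonzero' j (hj h)).mp h0 f
    exact ⟨x, hx.symm⟩
  · exact ⟨0, by rw [V.hom_tensor_eq_zero hC h f, zero_smul]⟩

/-- Morphisms `𝟙 ⟶ a ⊗ b` vanish unless `a = b`. -/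
lemma VerlindeLines.unit_hom_eq_zero (V : VerlindeLines m hm C) (hC : IsFusionCategory C)
    {a b : Row m} (h : a ≠ b) (f : 𝟙_ C ⟶ V.X a ⊗ V.X b) : f = 0 := by
  by_contra hf
  refine dag_ne_zero hf ?_
  have h0 := V.hom_tensor_eq_zero hC (mt (Row.fuses_one_right hm a b).mp h)
    (UnitaryStructure.dag f ≫ V.unit.inv)
  rwa [← cancel_mono V.unit.inv, Limits.zero_comp]

lemma VerlindeLines.exists_eq_smul_of_unit_hom (V : VerlindeLines m hm C)
    (hC : IsFusionCategory C) {a : Row m} {p : V.X a ⊗ V.X a ⟶ 𝟙_ C} (hp : p ≠ 0)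
    (f : V.X a ⊗ V.X a ⟶ 𝟙_ C) : ∃ x : ℂ, f = x • p := by
  have hp' : p ≫ V.unit.inv ≠ 0 := by
    intro h
    apply hp
    rwa [← cancel_mono V.unit.inv, Limits.zero_comp]
  obtain ⟨x, hx⟩ := V.exists_eq_smul hC (fun _ => hp') (f ≫ V.unit.inv)
  refine ⟨x, ?_⟩
  rwa [← cancel_mono V.unit.inv, Linear.smul_comp]

end Simple

/-! ## Normalized solutions of the duality equations -/

section Duality

/-- The zigzag `a ⟶ (a ⊗ b) ⊗ a ⟶ a`. -/
def zig {C : Type u} [Category.{v} C] [MonoidalCategory C] {a b : C} (p : 𝟙_ C ⟶ a ⊗ b)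
    (q : b ⊗ a ⟶ 𝟙_ C) : a ⟶ a :=
  (λ_ a).inv ≫ p ▷ a ≫ (α_ _ _ _).hom ≫ a ◁ q ≫ (ρ_ a).hom

/-- The opposite zigzag `a ⟶ a ⊗ (b ⊗ a) ⟶ a`. -/
def zag {C : Type u} [Category.{v} C] [MonoidalCategory C] {a b : C} (p : 𝟙_ C ⟶ b ⊗ a)
    (q : a ⊗ b ⟶ 𝟙_ C) : a ⟶ a :=
  (ρ_ a).inv ≫ a ◁ p ≫ (α_ _ _ _).inv ≫ q ▷ a ≫ (λ_ a).hom

/-- Both sides are two copies of `p` side by side with `q` contracting the two middle strands. When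
`zig` and `zag` are scalars, this forces the scalars to agree. -/
lemma comp_zig_whiskerRight {C : Type u} [Category.{v} C] [MonoidalCategory C] {a : C}
    (p : 𝟙_ C ⟶ a ⊗ a) (q : a ⊗ a ⟶ 𝟙_ C) : p ≫ zig p q ▷ a = p ≫ a ◁ zag p q := by
  have h1 : zig p q ▷ a =
      (λ_ (a ⊗ a)).inv ≫ p ▷ (a ⊗ a) ≫ (𝟙 _ ⊗≫ (a ◁ q ▷ a) ⊗≫ 𝟙 (a ⊗ a)) := by
    simp only [zig]; monoidal
  have h2 : a ◁ zag p q =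
      (ρ_ (a ⊗ a)).inv ≫ (a ⊗ a) ◁ p ≫ (𝟙 _ ⊗≫ (a ◁ q ▷ a) ⊗≫ 𝟙 (a ⊗ a)) := by
    simp only [zag]; monoidal
  rw [h1, h2, leftUnitor_inv_naturality_assoc, rightUnitor_inv_naturality_assoc,
    whisker_exchange_assoc, unitors_inv_equal]

/-- After composing with `f`, both sides become `f ⊗ f` followed by the unitor of the unit, where
the two unitors agree. This makes the two canonical junctions at the label `1` consistent. -/
lemma unit_iso_whisker {C : Type u} [Category.{v} C] [MonoidalCategory C] {X : C}
    (f : X ≅ 𝟙_ C) : f.hom ▷ X ≫ (λ_ X).hom = X ◁ f.hom ≫ (ρ_ X).hom := by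
  rw [← cancel_mono f.hom, Category.assoc, Category.assoc, ← leftUnitor_naturality,
    ← rightUnitor_naturality, whisker_exchange_assoc, unitors_equal]

lemma zig_unit_iso {C : Type u} [Category.{v} C] [MonoidalCategory C] {X : C} (f : X ≅ 𝟙_ C) :
    zig ((λ_ (𝟙_ C)).inv ≫ (f.inv ⊗ₘ f.inv)) ((f.hom ⊗ₘ f.hom) ≫ (λ_ (𝟙_ C)).hom) = 𝟙 X := by
  have h1 : (f.hom ⊗ₘ f.hom) ≫ (λ_ (𝟙_ C)).hom = (X ◁ f.hom ≫ (ρ_ X).hom) ≫ f.hom := by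
    rw [← unit_iso_whisker, MonoidalCategory.tensorHom_def]
    simp
  have h2 : (λ_ (𝟙_ C)).inv ≫ (f.inv ⊗ₘ f.inv) = f.inv ≫ (ρ_ X).inv ≫ X ◁ f.inv := by
    rw [MonoidalCategory.tensorHom_def, unitors_inv_equal]
    simp
  rw [h1, ← unit_iso_whisker, h2, zig]
  have h3 : (λ_ X).inv ≫ (f.inv ≫ (ρ_ X).inv ≫ X ◁ f.inv) ▷ X ≫ (α_ X X X).hom ≫
      X ◁ ((f.hom ▷ X ≫ (λ_ X).hom) ≫ f.hom) ≫ (ρ_ X).hom =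
      ((λ_ X).inv ≫ f.inv ▷ X) ≫ ((ρ_ X).inv ▷ X ≫ (α_ X _ X).hom ≫ X ◁ (f.inv ≫ f.hom) ▷ X ≫
        X ◁ (λ_ X).hom) ≫ X ◁ f.hom ≫ (ρ_ X).hom := by
    simp
  have h4 : (ρ_ X).inv ▷ X ≫ (α_ X _ X).hom ≫ X ◁ (f.inv ≫ f.hom) ▷ X ≫ X ◁ (λ_ X).hom =
      𝟙 _ := by
    simp
  rw [h3, h4, Category.id_comp, ← unit_iso_whisker]
  simp

variable {m : ℕ} {hm : 3 ≤ m} {C : Type u} [Category.{v} C] [Abelian C] [Linear ℂ C]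
  [MonoidalCategory C] [MonoidalPreadditive C] [MonoidalLinear ℂ C] [UnitaryStructure C]

open UnitaryStructure

omit [UnitaryStructure C] in
lemma zig_smul_left {a b : C} (x : ℂ) (p : 𝟙_ C ⟶ a ⊗ b) (q : b ⊗ a ⟶ 𝟙_ C) :
    zig (x • p) q = x • zig p q := by
  simp [zig]

omit [UnitaryStructure C] in
lemma zig_smul_right {a b : C} (x : ℂ) (p : 𝟙_ C ⟶ a ⊗ b) (q : b ⊗ a ⟶ 𝟙_ C) :
    zig p (x • q) = x • zig p q := by
  simp [zig]

omit [MonoidalPreadditive C] [MonoidalLinear ℂ C] in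
lemma dag_zig {a b : C} (p : 𝟙_ C ⟶ a ⊗ b) (q : b ⊗ a ⟶ 𝟙_ C) :
    dag (zig p q) = zag (dag q) (dag p) := by
  simp [zig, zag, dag_comp, dag_whiskerLeft, dag_whiskerRight, dag_associator,
    dag_leftUnitor_inv, dag_rightUnitor]

omit [MonoidalPreadditive C] [MonoidalLinear ℂ C] in
/-- The square of the norm of a nonzero morphism out of the unit is positive. -/
lemma IsFusionCategory.exists_loop (hC : IsFusionCategory C) {Y : C} {p : 𝟙_ C ⟶ Y}
    (hp : p ≠ 0) : ∃ d : ℝ, 0 < d ∧ p ≫ dag p = (d : ℂ) • 𝟙 (𝟙_ C) := by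
  obtain ⟨g, hg⟩ := dag_pos p
  obtain ⟨z, rfl⟩ := hC.exists_smul_id_unit g
  -- Endomorphisms of the unit are scalars, so the square `g ≫ dag g` provided by `dag_pos` is
  -- `|z|²`.
  have h : p ≫ dag p = ((Complex.normSq z : ℝ) : ℂ) • 𝟙 (𝟙_ C) := by
    rw [hg, dag_smul, dag_id, Linear.smul_comp, Linear.comp_smul, Category.comp_id, smul_smul,
      Complex.mul_conj]
  refine ⟨Complex.normSq z, Complex.normSq_pos.mpr ?_, h⟩
  rintro rfl
  exact hp (dag_eq_zero p (by simpa using h))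

omit [MonoidalLinear ℂ C] in
/-- Simple lines are self-dual. -/
lemma VerlindeLines.exists_zig_ne_zero [RigidCategory C] (V : VerlindeLines m hm C)
    (hC : IsFusionCategory C) (a : Row m) :
    ∃ (p : 𝟙_ C ⟶ V.X a ⊗ V.X a) (q : V.X a ⊗ V.X a ⟶ 𝟙_ C), zig p q ≠ 0 := by
  -- The label of the dual is only propositionally equal to `a`; this transports the witnesses along
  -- that equality.
  have aux : ∀ {b : Row m} (_ : a = b) (p : 𝟙_ C ⟶ V.X a ⊗ V.X b) (q : V.X b ⊗ V.X a ⟶ 𝟙_ C),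
      zig p q ≠ 0 → ∃ (p : 𝟙_ C ⟶ V.X a ⊗ V.X a) (q : V.X a ⊗ V.X a ⟶ 𝟙_ C), zig p q ≠ 0 := by
    rintro _ rfl p q h
    exact ⟨p, q, h⟩
  -- The zigzag identity for `a` and its categorical dual splits into a sum over the simple summands
  -- of the dual. Some term is nonzero, and since `𝟙 ⟶ a ⊗ e i` vanishes for `e i ≠ a`, that summand
  -- is `a` itself.
  obtain ⟨k, e, π, ι, h⟩ := V.exists_resolution hC (V.X a)ᘁ
  have hz : zig (η_ (V.X a) (V.X a)ᘁ) (ε_ (V.X a) (V.X a)ᘁ) = 𝟙 (V.X a) := by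
    simp [zig]
  have hs : ∑ i, zig (η_ (V.X a) (V.X a)ᘁ ≫ V.X a ◁ π i) (ι i ▷ V.X a ≫ ε_ (V.X a) (V.X a)ᘁ) =
      𝟙 (V.X a) := by
    have : ∀ i, zig (η_ (V.X a) (V.X a)ᘁ ≫ V.X a ◁ π i) (ι i ▷ V.X a ≫ ε_ (V.X a) (V.X a)ᘁ) =
        ((λ_ (V.X a)).inv ≫ η_ (V.X a) (V.X a)ᘁ ▷ V.X a ≫ (α_ _ _ _).hom) ≫
          V.X a ◁ (π i ≫ ι i) ▷ V.X a ≫ V.X a ◁ ε_ (V.X a) (V.X a)ᘁ ≫ (ρ_ (V.X a)).hom := by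
      intro i; simp [zig]
    rw [Finset.sum_congr rfl fun i _ => this i, ← Preadditive.comp_sum, ← Preadditive.sum_comp,
      ← whiskerLeft_sum, ← sum_whiskerRight, h, ← hz]
    simp [zig]
  obtain ⟨i, -, hi⟩ := Finset.exists_ne_zero_of_sum_ne_zero (hs.trans_ne (V.id_ne_zero a))
  have hia : a = e i := by
    by_contra hne
    apply hi
    rw [V.unit_hom_eq_zero hC hne (η_ (V.X a) (V.X a)ᘁ ≫ V.X a ◁ π i)]
    simp [zig]
  exact aux hia _ _ hi

/-- Normalized solutions of the duality equations. -/
lemma VerlindeLines.exists_cups [RigidCategory C] (V : VerlindeLines m hm C)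
    (hC : IsFusionCategory C) (a : Row m) :
    ∃ (p p' : 𝟙_ C ⟶ V.X a ⊗ V.X a) (d : ℝ), zig p' (dag p) = 𝟙 _ ∧ zig p (dag p') = 𝟙 _ ∧
      p ≫ dag p = (d : ℂ) • 𝟙 _ ∧ p' ≫ dag p' = (d : ℂ) • 𝟙 _ ∧ p ≠ 0 := by
  obtain ⟨p, q, hpq⟩ := V.exists_zig_ne_zero hC a
  have hp : p ≠ 0 := by
    rintro rfl
    exact hpq (by simp [zig])
  -- Pairings `a ⊗ a ⟶ 𝟙` form a line, so `q` may be traded for a multiple of `dag p`.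
  obtain ⟨t, rfl⟩ := V.exists_eq_smul_of_unit_hom hC (dag_ne_zero hp) q
  rw [zig_smul_right] at hpq
  obtain ⟨κ, hκ⟩ := V.exists_smul_id hC (zig p (dag p))
  have hκ0 : κ ≠ 0 := by
    rintro rfl
    exact hpq (by rw [hκ]; simp)
  have hκ' : zag p (dag p) = (starRingEnd ℂ κ) • 𝟙 (V.X a) := by
    have := dag_zig p (dag p)
    rw [dag_dag, hκ, dag_smul, dag_id] at this
    exact this.symm
  -- The zigzag is `κ` and its dagger, the opposite zigzag, is the conjugate of `κ`. Both act
  -- equally on `p`, so `κ` is real.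
  have hreal : starRingEnd ℂ κ = κ := by
    have h := comp_zig_whiskerRight p (dag p)
    rw [hκ, hκ', MonoidalLinear.smul_whiskerRight, MonoidalLinear.whiskerLeft_smul,
      id_whiskerRight, whiskerLeft_id, Linear.comp_smul, Linear.comp_smul,
      Category.comp_id] at h
    have h2 : (κ - starRingEnd ℂ κ) • p = 0 := by rw [sub_smul, h, sub_self]
    exact (sub_eq_zero.mp ((smul_eq_zero.mp h2).resolve_right hp)).symm
  obtain ⟨r, rfl⟩ := Complex.conj_eq_iff_real.mp hreal
  have hr : r ≠ 0 := by rintro rfl; simp at hκ0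
  obtain ⟨d, hd, hloop⟩ := hC.exists_loop hp
  -- Rescaling by `s = |r|^(-1/2)` normalizes the zigzag up to the sign `ε` of `r`, the
  -- Frobenius-Schur sign. The sign is absorbed into the second cup only, which leaves both loops
  -- equal since `ε² = 1`.
  set s : ℝ := (Real.sqrt |r|)⁻¹
  have hs : s * s * |r| = 1 := by
    have := Real.mul_self_sqrt (abs_nonneg r)
    have h0 : Real.sqrt |r| ≠ 0 := (Real.sqrt_pos.mpr (abs_pos.mpr hr)).ne'
    simp only [s]
    field_simp
    rw [sq, this]
  have hs0 : s ≠ 0 := by rintro h; simp [h] at hs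
  set ε : ℝ := r / |r|
  have hε : ε * ε = 1 := by
    have := abs_mul_abs_self r
    simp only [ε]
    rw [div_mul_div_comm, this, div_self (mul_ne_zero hr hr)]
  have hεr : ε * |r| = r := div_mul_cancel₀ _ (abs_ne_zero.mpr hr)
  have hmain : ε * s * s * r = 1 := by
    linear_combination (-(ε * s * s)) * hεr + (s * s * |r|) * hε + hs
  have hmainC : (ε : ℂ) * s * s * r = 1 := by exact_mod_cast hmain
  refine ⟨(s : ℂ) • p, ((ε * s : ℝ) : ℂ) • p, s * s * d, ?_, ?_, ?_, ?_, ?_⟩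
  · rw [dag_smul, zig_smul_left, zig_smul_right, hκ, smul_smul, smul_smul, Complex.conj_ofReal]
    push_cast
    rw [hmainC, one_smul]
  · rw [dag_smul, zig_smul_left, zig_smul_right, hκ, smul_smul, smul_smul, Complex.conj_ofReal]
    push_cast
    rw [show (s : ℂ) * (ε * s) * r = 1 by rw [← hmainC]; ring, one_smul]
  · rw [dag_smul, Linear.smul_comp, Linear.comp_smul, hloop, smul_smul, smul_smul,
      Complex.conj_ofReal]
    congr 1
    push_cast
    ring
  · rw [dag_smul, Linear.smul_comp, Linear.comp_smul, hloop, smul_smul, smul_smul,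
      Complex.conj_ofReal]
    congr 1
    norm_cast
    linear_combination s * s * d * hε
  · exact smul_ne_zero (by exact_mod_cast hs0) hp

/-! ## The unit line -/

/-- The canonical isomorphism `𝟙 ⟶ 1 ⊗ 1`. -/
def VerlindeLines.unitCup (V : VerlindeLines m hm C) :
    𝟙_ C ⟶ V.X (Row.one hm) ⊗ V.X (Row.one hm) :=
  (λ_ (𝟙_ C)).inv ≫ (V.unit.inv ⊗ₘ V.unit.inv)

omit [MonoidalPreadditive C] [MonoidalLinear ℂ C]

lemma VerlindeLines.dag_unit_inv (V : VerlindeLines m hm C) :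
    dag V.unit.inv = V.unit.hom := by
  rw [← V.unit_unitary, dag_dag]

lemma VerlindeLines.dag_unitCup (V : VerlindeLines m hm C) :
    dag V.unitCup = (V.unit.hom ⊗ₘ V.unit.hom) ≫ (λ_ (𝟙_ C)).hom := by
  rw [unitCup, dag_comp, dag_tensor, V.dag_unit_inv, dag_leftUnitor_inv]

lemma VerlindeLines.unitCup_loop (V : VerlindeLines m hm C) :
    V.unitCup ≫ dag V.unitCup = 𝟙 _ := by
  rw [V.dag_unitCup, unitCup, Category.assoc, tensorHom_comp_tensorHom_assoc]
  simp

lemma VerlindeLines.zig_unitCup (V : VerlindeLines m hm C) :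
    zig V.unitCup (dag V.unitCup) = 𝟙 _ := by
  rw [V.dag_unitCup, unitCup, zig_unit_iso]

lemma VerlindeLines.dag_unitCup_comp (V : VerlindeLines m hm C) :
    dag V.unitCup ≫ V.unit.inv = V.unit.hom ▷ V.X (Row.one hm) ≫ (λ_ _).hom := by
  rw [V.dag_unitCup, MonoidalCategory.tensorHom_def]
  simp

end Duality

/-! ## Junction bases -/

section JunctionBases

variable {m : ℕ} {hm : 3 ≤ m} {C : Type u} [Category.{v} C] [Abelian C] [Linear ℂ C]
  [MonoidalCategory C] [UnitaryStructure C]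

open UnitaryStructure

lemma VerlindeLines.left_ne_zero (V : VerlindeLines m hm C) (b : Row m) :
    V.unit.hom ▷ V.X b ≫ (λ_ (V.X b)).hom ≠ 0 := by
  have := V.simple b
  intro h
  apply id_nonzero (V.X b)
  rw [← cancel_epi (V.unit.hom ▷ V.X b ≫ (λ_ (V.X b)).hom), h, Limits.zero_comp,
    Limits.zero_comp]

lemma VerlindeLines.right_ne_zero (V : VerlindeLines m hm C) (a : Row m) :
    V.X a ◁ V.unit.hom ≫ (ρ_ (V.X a)).hom ≠ 0 := by
  have := V.simple a
  intro h
  apply id_nonzero (V.X a)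
  rw [← cancel_epi (V.X a ◁ V.unit.hom ≫ (ρ_ (V.X a)).hom), h, Limits.zero_comp,
    Limits.zero_comp]

/-- The three canonical prescriptions overlap only at `a = b = c = 1`, where they agree by
`unit_iso_whisker` and the normalization `h1`. Heterogeneous equality lets each be stated under
equalities of labels. -/
lemma VerlindeLines.exists_junction (V : VerlindeLines m hm C)
    (cup : ∀ a, 𝟙_ C ⟶ V.X a ⊗ V.X a) (h0 : ∀ a, cup a ≠ 0)
    (h1 : cup (Row.one hm) = V.unitCup) (a b c : Row m) :
    ∃ j : V.X a ⊗ V.X b ⟶ V.X c, (Row.Fuses a b c → j ≠ 0) ∧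
      (a = Row.one hm → b = c → HEq j (V.unit.hom ▷ V.X b ≫ (λ_ (V.X b)).hom)) ∧
      (b = Row.one hm → a = c → HEq j (V.X a ◁ V.unit.hom ≫ (ρ_ (V.X a)).hom)) ∧
      (a = b → c = Row.one hm → HEq j (dag (cup a) ≫ V.unit.inv)) := by
  by_cases hl : a = Row.one hm ∧ b = c
  · obtain ⟨rfl, rfl⟩ := hl
    refine ⟨_, fun _ => V.left_ne_zero b, fun _ _ => HEq.rfl, ?_, ?_⟩
    · rintro rfl -
      exact heq_of_eq (unit_iso_whisker _)
    · rintro rfl -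
      rw [h1, V.dag_unitCup_comp]
  by_cases hr : b = Row.one hm ∧ a = c
  · obtain ⟨rfl, rfl⟩ := hr
    refine ⟨_, fun _ => V.right_ne_zero a, fun h h' => (hl ⟨h, h'⟩).elim,
      fun _ _ => HEq.rfl, fun h _ => (hl ⟨h, h.symm⟩).elim⟩
  by_cases hd : a = b ∧ c = Row.one hm
  · obtain ⟨rfl, rfl⟩ := hd
    refine ⟨_, fun _ h => ?_, fun h h' => (hl ⟨h, h'⟩).elim, fun h h' => (hr ⟨h, h'⟩).elim,
      fun _ _ => HEq.rfl⟩
    refine dag_ne_zero (h0 a) ?_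
    rwa [← cancel_mono V.unit.inv, Limits.zero_comp]
  · have : ∃ j : V.X a ⊗ V.X b ⟶ V.X c, Row.Fuses a b c → j ≠ 0 := by
      by_cases hf : Row.Fuses a b c
      · obtain ⟨j, hj⟩ := V.exists_hom_tensor_ne_zero hf
        exact ⟨j, fun _ => hj⟩
      · exact ⟨0, fun h => (hf h).elim⟩
    obtain ⟨j, hj⟩ := this
    exact ⟨j, hj, fun h h' => (hl ⟨h, h'⟩).elim, fun h h' => (hr ⟨h, h'⟩).elim,
      fun h h' => (hd ⟨h, h'⟩).elim⟩

lemma VerlindeLines.nonempty_junctions [MonoidalPreadditive C] [MonoidalLinear ℂ C]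
    [RigidCategory C] (V : VerlindeLines m hm C) (hC : IsFusionCategory C) :
    Nonempty (Junctions V) := by
  have hcups : ∀ a : Row m, ∃ (p p' : 𝟙_ C ⟶ V.X a ⊗ V.X a) (d : ℝ),
      zig p' (dag p) = 𝟙 _ ∧ zig p (dag p') = 𝟙 _ ∧ p ≫ dag p = (d : ℂ) • 𝟙 _ ∧
      p' ≫ dag p' = (d : ℂ) • 𝟙 _ ∧ p ≠ 0 ∧ (a = Row.one hm → HEq p V.unitCup) := by
    intro a
    -- At the unit label a general normalized cup would be fixed only up to a phase, so the
    -- canonical one is imposed to match the unit junctions.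
    by_cases ha : a = Row.one hm
    · subst ha
      refine ⟨V.unitCup, V.unitCup, 1, V.zig_unitCup, V.zig_unitCup, ?_, ?_, ?_,
        fun _ => HEq.rfl⟩
      · simpa using V.unitCup_loop
      · simpa using V.unitCup_loop
      · intro h
        have hz := V.zig_unitCup
        rw [h] at hz
        exact V.id_ne_zero _ (hz.symm.trans (by simp [zig]))
    · obtain ⟨p, p', d, h1, h2, h3, h4, h5⟩ := V.exists_cups hC a
      exact ⟨p, p', d, h1, h2, h3, h4, h5, fun h => (ha h).elim⟩
  choose cup cup' dim hz hz' hl hl' h0 h1 using hcups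
  choose j hj hjl hjr hjd using V.exists_junction cup h0 (eq_of_heq (h1 _ rfl))
  exact ⟨{
    j := j
    cup := cup
    cup' := cup'
    dim := dim
    j_ne_zero := hj
    j_one_left := fun b => eq_of_heq (hjl _ b b rfl rfl)
    j_one_right := fun a => eq_of_heq (hjr a _ a rfl rfl)
    j_dual := fun a => eq_of_heq (hjd a a _ rfl rfl)
    zigzag := hz
    zigzag' := hz'
    loop := hl
    loop' := hl' }⟩

variable {V : VerlindeLines m hm C}

lemma Junctions.j_eq_zero (J : Junctions V) (hC : IsFusionCategory C) {a b c : Row m}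
    (h : ¬ Row.Fuses a b c) : J.j a b c = 0 :=
  V.hom_tensor_eq_zero hC h _

lemma Junctions.exists_eq_smul (J : Junctions V) (hC : IsFusionCategory C) {a b c : Row m}
    (f : V.X a ⊗ V.X b ⟶ V.X c) : ∃ x : ℂ, f = x • J.j a b c :=
  V.exists_eq_smul hC (J.j_ne_zero a b c) f

/-- Dual basis vectors of the junctions resolve the identity of a product of two lines. -/
lemma Junctions.exists_dual_basis (J : Junctions V) (hC : IsFusionCategory C) (a b : Row m) :
    ∃ p : ∀ c, V.X c ⟶ V.X a ⊗ V.X b, (∀ c, Row.Fuses a b c → p c ≫ J.j a b c = 𝟙 _) ∧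
      (∀ c c', c ≠ c' → p c ≫ J.j a b c' = 0) ∧ ∑ c, J.j a b c ≫ p c = 𝟙 _ := by
  have hex : ∀ c, ∃ p : V.X c ⟶ V.X a ⊗ V.X b, Row.Fuses a b c → p ≫ J.j a b c = 𝟙 _ := by
    intro c
    by_cases h : Row.Fuses a b c
    -- The dual vector is the dagger of the junction, divided by the scalar `dag j ≫ j`, which is
    -- nonzero by positivity.
    · obtain ⟨x, hx⟩ := V.exists_smul_id hC (dag (J.j a b c) ≫ J.j a b c)
      have hx0 : x ≠ 0 := by
        rintro rfl
        exact dag_comp_self_ne_zero (J.j_ne_zero a b c h) (by rw [hx, zero_smul])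
      refine ⟨x⁻¹ • dag (J.j a b c), fun _ => ?_⟩
      rw [Linear.smul_comp, hx, smul_smul, inv_mul_cancel₀ hx0, one_smul]
    · exact ⟨0, fun h' => (h h').elim⟩
  choose p hp using hex
  have hp0 : ∀ c c', c ≠ c' → p c ≫ J.j a b c' = 0 := fun c c' h => V.hom_eq_zero h _
  refine ⟨p, hp, hp0, ?_⟩
  -- The endomorphism `∑ j ≫ p` fixes every basis junction, hence every morphism to a simple line.
  -- Resolving `a ⊗ b` into simple lines then shows that it is the identity.
  have hj : ∀ c, (∑ c, J.j a b c ≫ p c) ≫ J.j a b c = J.j a b c := by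
    intro c
    rw [Preadditive.sum_comp, Finset.sum_eq_single c]
    · by_cases h : Row.Fuses a b c
      · rw [Category.assoc, hp c h, Category.comp_id]
      · rw [J.j_eq_zero hC h, Limits.comp_zero]
    · intro c' _ h
      rw [Category.assoc, hp0 c' c h, Limits.comp_zero]
    · intro h
      exact (h (Finset.mem_univ c)).elim
  obtain ⟨k, e, π, ι, h⟩ := V.exists_resolution hC (V.X a ⊗ V.X b)
  have hπ : ∀ i, (∑ c, J.j a b c ≫ p c) ≫ π i = π i := by
    intro i
    obtain ⟨x, hx⟩ := J.exists_eq_smul hC (π i)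
    rw [hx, Linear.comp_smul, hj]
  calc _ = (∑ c, J.j a b c ≫ p c) ≫ ∑ i, π i ≫ ι i := by rw [h, Category.comp_id]
    _ = ∑ i, π i ≫ ι i := by
      rw [Preadditive.comp_sum]
      exact Finset.sum_congr rfl fun i _ => by rw [← Category.assoc, hπ]
    _ = 𝟙 _ := h

end JunctionBases

/-! ## Change of basis -/

/-- Two bases indexed by subsets of the same finite type are related by a unique pair of mutually
inverse matrices supported on these subsets. -/
lemma exists_transition_matrices {ι M : Type*} [Fintype ι] [DecidableEq ι] [AddCommGroup M]
    [Module ℂ M] {A B : ι → Prop} {L R : ι → M} (hL : ∀ e, ¬ A e → L e = 0)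
    (hR : ∀ f, ¬ B f → R f = 0)
    (spanL : ∀ φ : M, ∃ x : ι → ℂ, φ = ∑ e, x e • L e)
    (spanR : ∀ φ : M, ∃ x : ι → ℂ, φ = ∑ f, x f • R f)
    (indL : ∀ x : ι → ℂ, ∑ e, x e • L e = 0 → ∀ e, A e → x e = 0)
    (indR : ∀ x : ι → ℂ, ∑ f, x f • R f = 0 → ∀ f, B f → x f = 0) :
    ∃ F G : ι → ι → ℂ, (∀ e, A e → L e = ∑ f, F e f • R f) ∧
      (∀ e f, ¬ (A e ∧ B f) → F e f = 0 ∧ G e f = 0) ∧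
      (∀ e e', A e → A e' → ∑ f, F e f * G e' f = if e = e' then 1 else 0) ∧
      (∀ f f', B f → B f' → ∑ e, G e f * F e f' = if f = f' then 1 else 0) := by
  classical
  choose F₀ hF₀ using fun e => spanR (L e)
  choose G₀ hG₀ using fun f => spanL (R f)
  -- Truncation to admissible entries loses nothing, because `L` and `R` vanish off `A` and `B`.
  let F : ι → ι → ℂ := fun e f => if A e ∧ B f then F₀ e f else 0
  let G : ι → ι → ℂ := fun e f => if A e ∧ B f then G₀ f e else 0
  have hF : ∀ e, A e → L e = ∑ f, F e f • R f := by
    intro e he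
    refine (hF₀ e).trans (Finset.sum_congr rfl fun f _ => ?_)
    by_cases hf : B f
    · simp [F, he, hf]
    · simp [hR f hf]
  have hG : ∀ f, B f → R f = ∑ e, G e f • L e := by
    intro f hf
    refine (hG₀ f).trans (Finset.sum_congr rfl fun e _ => ?_)
    by_cases he : A e
    · simp [G, he, hf]
    · simp [hL e he]
  -- Stated for arbitrary families so that the second inverse relation follows by exchanging the
  -- roles of `L` and `R`.
  have key : ∀ {A B : ι → Prop} {L R : ι → M} {F G : ι → ι → ℂ}
      (_ : ∀ e f, ¬ (A e ∧ B f) → F e f = 0)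
      (_ : ∀ x : ι → ℂ, ∑ e, x e • L e = 0 → ∀ e, A e → x e = 0)
      (_ : ∀ e, A e → L e = ∑ f, F e f • R f) (_ : ∀ f, B f → R f = ∑ e, G e f • L e)
      (e e' : ι), A e → A e' → ∑ f, F e f * G e' f = if e = e' then 1 else 0 := by
    intro A B L R F G h0 ind hF hG e e' he he'
    have h := ind (fun e' => ∑ f, F e f * G e' f - if e = e' then 1 else 0) ?_ e' he'
    · exact sub_eq_zero.mp h
    · simp only [sub_smul, ite_smul, one_smul, zero_smul, Finset.sum_sub_distrib,
        Finset.sum_ite_eq, Finset.mem_univ, if_true, Finset.sum_smul]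
      rw [Finset.sum_comm, sub_eq_zero]
      conv_rhs => rw [hF e he]
      refine Finset.sum_congr rfl fun f _ => ?_
      by_cases hf : B f
      · rw [hG f hf, Finset.smul_sum]
        exact Finset.sum_congr rfl fun _ _ => mul_smul _ _ _
      · simp [h0 e f (fun h => hf h.2)]
  refine ⟨F, G, hF, fun e f h => ⟨if_neg h, if_neg h⟩, key (fun e f h => if_neg h) indL hF hG,
    fun f f' hf hf' => ?_⟩
  have h := key (F := fun f e => G e f) (G := fun f e => F e f) (A := B) (B := A)
    (fun f e h => if_neg (fun h' => h h'.symm)) indR hG hF f f' hf hf'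
  exact h

/-! ## Fusion trees and `F`-symbols -/

section FSymbols

variable {m : ℕ} {hm : 3 ≤ m} {C : Type u} [Category.{v} C] [Abelian C] [Linear ℂ C]
  [MonoidalCategory C] [UnitaryStructure C] {V : VerlindeLines m hm C}

lemma Junctions.treeL_eq_zero [MonoidalPreadditive C] (J : Junctions V) (hC : IsFusionCategory C)
    {a b c d e : Row m} (h : ¬ (Row.Fuses a b e ∧ Row.Fuses e c d)) : J.treeL a b c d e = 0 := by
  rw [Junctions.treeL]
  by_cases h' : Row.Fuses a b e
  · rw [J.j_eq_zero hC fun h'' => h ⟨h', h''⟩, Limits.comp_zero]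
  · rw [J.j_eq_zero hC h', MonoidalPreadditive.zero_whiskerRight, Limits.zero_comp]

lemma Junctions.treeR_eq_zero [MonoidalPreadditive C] (J : Junctions V) (hC : IsFusionCategory C)
    {a b c d f : Row m} (h : ¬ (Row.Fuses b c f ∧ Row.Fuses a f d)) : J.treeR a b c d f = 0 := by
  rw [Junctions.treeR]
  by_cases h' : Row.Fuses b c f
  · rw [J.j_eq_zero hC fun h'' => h ⟨h', h''⟩, Limits.comp_zero, Limits.comp_zero]
  · rw [J.j_eq_zero hC h', MonoidalPreadditive.whiskerLeft_zero, Limits.zero_comp,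
      Limits.comp_zero]

variable [MonoidalPreadditive C] [MonoidalLinear ℂ C]

omit [MonoidalLinear ℂ C] in
-- Inserting the resolution of the identity of `a ⊗ b` leaves, in each channel `e`, a vector of
-- `Hom(e ⊗ c, d)`, a space spanned by the basis junction.
lemma Junctions.treeL_span (J : Junctions V) (hC : IsFusionCategory C) (a b c d : Row m)
    (φ : (V.X a ⊗ V.X b) ⊗ V.X c ⟶ V.X d) : ∃ x : Row m → ℂ, φ = ∑ e, x e • J.treeL a b c d e := by
  obtain ⟨p, -, -, h⟩ := J.exists_dual_basis hC a b
  choose x hx using fun e => J.exists_eq_smul hC (p e ▷ V.X c ≫ φ)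
  refine ⟨x, ?_⟩
  calc φ = (∑ e, J.j a b e ≫ p e) ▷ V.X c ≫ φ := by rw [h, id_whiskerRight, Category.id_comp]
    _ = ∑ e, J.j a b e ▷ V.X c ≫ p e ▷ V.X c ≫ φ := by
      rw [sum_whiskerRight, Preadditive.sum_comp]
      exact Finset.sum_congr rfl fun e _ => by rw [comp_whiskerRight, Category.assoc]
    _ = _ := Finset.sum_congr rfl fun e _ => by rw [hx e, Linear.comp_smul, Junctions.treeL]

omit [MonoidalLinear ℂ C] in
lemma Junctions.treeR_span (J : Junctions V) (hC : IsFusionCategory C) (a b c d : Row m)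
    (φ : (V.X a ⊗ V.X b) ⊗ V.X c ⟶ V.X d) : ∃ x : Row m → ℂ, φ = ∑ f, x f • J.treeR a b c d f := by
  obtain ⟨p, -, -, h⟩ := J.exists_dual_basis hC b c
  choose x hx using fun f => J.exists_eq_smul hC (V.X a ◁ p f ≫ (α_ _ _ _).inv ≫ φ)
  refine ⟨x, ?_⟩
  calc φ = (α_ _ _ _).hom ≫ V.X a ◁ (∑ f, J.j b c f ≫ p f) ≫ (α_ _ _ _).inv ≫ φ := by
        rw [h, whiskerLeft_id, Category.id_comp, Iso.hom_inv_id_assoc]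
    _ = ∑ f, (α_ _ _ _).hom ≫ V.X a ◁ J.j b c f ≫ V.X a ◁ p f ≫ (α_ _ _ _).inv ≫ φ := by
      rw [whiskerLeft_sum, Preadditive.sum_comp, Preadditive.comp_sum]
      exact Finset.sum_congr rfl fun f _ => by rw [MonoidalCategory.whiskerLeft_comp, Category.assoc]
    _ = _ := Finset.sum_congr rfl fun f _ => by
      rw [hx f, Linear.comp_smul, Linear.comp_smul, Junctions.treeR]

omit [MonoidalLinear ℂ C] in
-- Precomposing with the dual vector `p e` isolates the channel `e`.
lemma Junctions.treeL_independent (J : Junctions V) (hC : IsFusionCategory C) (a b c d : Row m)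
    (x : Row m → ℂ) (hx : ∑ e, x e • J.treeL a b c d e = 0) (e : Row m)
    (he : Row.Fuses a b e ∧ Row.Fuses e c d) : x e = 0 := by
  obtain ⟨p, hp, hp0, -⟩ := J.exists_dual_basis hC a b
  have h : p e ▷ V.X c ≫ ∑ e', x e' • J.treeL a b c d e' = x e • J.j e c d := by
    rw [Preadditive.comp_sum, Finset.sum_eq_single e]
    · rw [Linear.comp_smul, Junctions.treeL, ← Category.assoc, ← comp_whiskerRight, hp e he.1,
        id_whiskerRight, Category.id_comp]
    · intro e' _ hne
      rw [Linear.comp_smul, Junctions.treeL, ← Category.assoc, ← comp_whiskerRight,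
        hp0 e e' hne.symm, MonoidalPreadditive.zero_whiskerRight, Limits.zero_comp, smul_zero]
    · exact fun h => (h (Finset.mem_univ e)).elim
  rw [hx, Limits.comp_zero] at h
  exact (smul_eq_zero.mp h.symm).resolve_right (J.j_ne_zero _ _ _ he.2)

omit [MonoidalLinear ℂ C] in
lemma Junctions.treeR_independent (J : Junctions V) (hC : IsFusionCategory C) (a b c d : Row m)
    (x : Row m → ℂ) (hx : ∑ f, x f • J.treeR a b c d f = 0) (f : Row m)
    (hf : Row.Fuses b c f ∧ Row.Fuses a f d) : x f = 0 := by
  obtain ⟨p, hp, hp0, -⟩ := J.exists_dual_basis hC b c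
  have h : (V.X a ◁ p f ≫ (α_ _ _ _).inv) ≫ ∑ f', x f' • J.treeR a b c d f' =
      x f • J.j a f d := by
    rw [Preadditive.comp_sum, Finset.sum_eq_single f]
    · rw [Linear.comp_smul, Junctions.treeR, Category.assoc, Iso.inv_hom_id_assoc,
        ← Category.assoc, ← MonoidalCategory.whiskerLeft_comp, hp f hf.1, whiskerLeft_id,
        Category.id_comp]
    · intro f' _ hne
      rw [Linear.comp_smul, Junctions.treeR, Category.assoc, Iso.inv_hom_id_assoc,
        ← Category.assoc, ← MonoidalCategory.whiskerLeft_comp, hp0 f f' hne.symm,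
        MonoidalPreadditive.whiskerLeft_zero, Limits.zero_comp, smul_zero]
    · exact fun h => (h (Finset.mem_univ f)).elim
  rw [hx, Limits.comp_zero] at h
  exact (smul_eq_zero.mp h.symm).resolve_right (J.j_ne_zero _ _ _ hf.2)

omit [MonoidalLinear ℂ C] in
/-- The inverse `F`-move. -/
lemma Junctions.IsFSymbol.move_inv [DecidableEq (Row m)] {J : Junctions V}
    (hC : IsFusionCategory C) {F Finv : Row m → Row m → Row m → Row m → Row m → Row m → ℂ}
    (h : J.IsFSymbol F Finv) {a b c d f : Row m} (hf : Row.Fuses b c f ∧ Row.Fuses a f d) :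
    J.treeR a b c d f = ∑ e, Finv a b c d e f • J.treeL a b c d e := by
  have h1 : ∀ e, Finv a b c d e f • J.treeL a b c d e =
      ∑ f', (Finv a b c d e f * F a b c d e f') • J.treeR a b c d f' := by
    intro e
    by_cases he : Row.Fuses a b e ∧ Row.Fuses e c d
    · rw [h.move a b c d e he.1 he.2, finsum_eq_sum_of_fintype, Finset.smul_sum]
      exact Finset.sum_congr rfl fun _ _ => smul_smul _ _ _
    · rw [J.treeL_eq_zero hC he, smul_zero]
      refine (Finset.sum_eq_zero fun f' _ => ?_).symm
      rw [(h.support a b c d e f' fun h' => he ⟨h'.1, h'.2.1⟩).1, mul_zero, zero_smul]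
  rw [Finset.sum_congr rfl fun e _ => h1 e, Finset.sum_comm, Finset.sum_eq_single f]
  · have h2 := h.inv_left a b c d f f hf.1 hf.2 hf.1 hf.2
    rw [finsum_eq_sum_of_fintype, if_pos rfl] at h2
    rw [← Finset.sum_smul, h2, one_smul]
  · intro f' _ hne
    by_cases hf' : Row.Fuses b c f' ∧ Row.Fuses a f' d
    · have h2 := h.inv_left a b c d f f' hf.1 hf.2 hf'.1 hf'.2
      rw [finsum_eq_sum_of_fintype, if_neg hne.symm] at h2
      rw [← Finset.sum_smul, h2, zero_smul]
    · simp [J.treeR_eq_zero hC hf']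
  · exact fun h => (h (Finset.mem_univ f)).elim

omit [MonoidalLinear ℂ C] in
-- The admissible trees of each bracketing form a basis of the same space, and `F` is the change of
-- basis. Uniqueness of the inverse entries follows from the inverse `F`-move and independence of
-- the left trees.
lemma Junctions.existsUnique_isFSymbol [DecidableEq (Row m)] (J : Junctions V)
    (hC : IsFusionCategory C) :
    ∃! F : (Row m → Row m → Row m → Row m → Row m → Row m → ℂ) ×
      (Row m → Row m → Row m → Row m → Row m → Row m → ℂ), J.IsFSymbol F.1 F.2 := by
  choose F G hF h0 hFG hGF using fun a b c d => exists_transition_matrices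
    (fun e => J.treeL_eq_zero hC (a := a) (b := b) (c := c) (d := d) (e := e))
    (fun f => J.treeR_eq_zero hC (a := a) (b := b) (c := c) (d := d) (f := f))
    (J.treeL_span hC a b c d) (J.treeR_span hC a b c d) (J.treeL_independent hC a b c d)
    (J.treeR_independent hC a b c d)
  have key : ∀ {F G F' G' : Row m → Row m → Row m → Row m → Row m → Row m → ℂ},
      J.IsFSymbol F G → J.IsFSymbol F' G' → ∀ a b c d e f,
      F a b c d e f = F' a b c d e f ∧ G a b c d e f = G' a b c d e f := by
    intro F G F' G' H H' a b c d e f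
    by_cases hs : Row.Fuses a b e ∧ Row.Fuses e c d ∧ Row.Fuses b c f ∧ Row.Fuses a f d
    · constructor
      · refine sub_eq_zero.mp (J.treeR_independent hC a b c d
          (fun f => F a b c d e f - F' a b c d e f) ?_ f hs.2.2)
        have h1 := H.move a b c d e hs.1 hs.2.1
        have h2 := H'.move a b c d e hs.1 hs.2.1
        rw [finsum_eq_sum_of_fintype] at h1 h2
        simp only [sub_smul, Finset.sum_sub_distrib]
        rw [← h1, ← h2, sub_self]
      · refine sub_eq_zero.mp (J.treeL_independent hC a b c d
          (fun e => G a b c d e f - G' a b c d e f) ?_ e ⟨hs.1, hs.2.1⟩)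
        have h1 := H.move_inv hC hs.2.2
        have h2 := H'.move_inv hC hs.2.2
        simp only [sub_smul, Finset.sum_sub_distrib]
        rw [← h1, ← h2, sub_self]
    · obtain ⟨h1, h2⟩ := H.support a b c d e f hs
      obtain ⟨h3, h4⟩ := H'.support a b c d e f hs
      exact ⟨h1.trans h3.symm, h2.trans h4.symm⟩
  have hFG' : J.IsFSymbol F G := by
    refine ⟨?_, ?_, ?_, ?_⟩
    · intro a b c d e h1 h2
      rw [finsum_eq_sum_of_fintype]
      exact hF a b c d e ⟨h1, h2⟩
    · exact fun a b c d e f h => h0 a b c d e f fun h' => h ⟨h'.1.1, h'.1.2, h'.2⟩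
    · intro a b c d e e' h1 h2 h3 h4
      rw [finsum_eq_sum_of_fintype]
      exact hFG a b c d e e' ⟨h1, h2⟩ ⟨h3, h4⟩
    · intro a b c d e e' h1 h2 h3 h4
      rw [finsum_eq_sum_of_fintype]
      exact hGF a b c d e e' ⟨h1, h2⟩ ⟨h3, h4⟩
  refine ⟨(F, G), hFG', ?_⟩
  rintro ⟨F', G'⟩ H
  refine Prod.ext ?_ ?_
  · funext a b c d e f
    exact (key H hFG' a b c d e f).1
  · funext a b c d e f
    exact (key H hFG' a b c d e f).2

/-! ## Special values of the `F`-symbols -/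

omit [MonoidalLinear ℂ C] in
lemma Junctions.cup_ne_zero (J : Junctions V) (n : Row m) : J.cup n ≠ 0 := by
  intro h
  refine V.id_ne_zero n ((J.zigzag' n).symm.trans ?_)
  rw [h]
  simp

omit [MonoidalLinear ℂ C] in
lemma Junctions.dim_pos (J : Junctions V) (hC : IsFusionCategory C) (n : Row m) :
    0 < J.dim n := by
  obtain ⟨d, hd, h⟩ := hC.exists_loop (J.cup_ne_zero n)
  have h' := h.symm.trans (J.loop n)
  have := hC.simple_unit
  have h0 : ((d : ℂ) - J.dim n) • 𝟙 (𝟙_ C) = 0 := by rw [sub_smul, h', sub_self]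
  have h1 := sub_eq_zero.mp ((smul_eq_zero.mp h0).resolve_right (id_nonzero _))
  rwa [← Complex.ofReal_injective h1]

omit [MonoidalPreadditive C] [MonoidalLinear ℂ C] in
-- The composite is a morphism from the unit line to a different simple line.
lemma Junctions.cup_comp_j_eq_zero (J : Junctions V) {n e : Row m} (h : Row.one hm ≠ e) :
    J.cup n ≫ J.j n n e = 0 := by
  rw [← cancel_epi V.unit.hom, V.hom_eq_zero h (V.unit.hom ≫ _), Limits.comp_zero]

omit [MonoidalPreadditive C] [MonoidalLinear ℂ C] in
lemma Junctions.cup_comp_j_one (J : Junctions V) (n : Row m) :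
    J.cup n ≫ J.j n n (Row.one hm) = (J.dim n : ℂ) • V.unit.inv := by
  rw [J.j_dual, ← Category.assoc, J.loop, Linear.smul_comp, Category.id_comp]

/-- Of all channels in the inverse `F`-move, the cup survives only in the identity one, where it
closes to a loop. This turns a single inverse `F`-symbol into the value of a diagram. -/
lemma Junctions.IsFSymbol.cup_comp_treeR [DecidableEq (Row m)] {J : Junctions V}
    (hC : IsFusionCategory C) {F Finv : Row m → Row m → Row m → Row m → Row m → Row m → ℂ}
    (h : J.IsFSymbol F Finv) {n c d s : Row m} (hs : Row.Fuses n c s ∧ Row.Fuses n s d) :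
    J.cup n ▷ V.X c ≫ J.treeR n n c d s =
      (Finv n n c d (Row.one hm) s * J.dim n) • V.unit.inv ▷ V.X c ≫ J.j (Row.one hm) c d := by
  rw [h.move_inv hC hs, Preadditive.comp_sum, Finset.sum_eq_single (Row.one hm)]
  · rw [Linear.comp_smul, Junctions.treeL, ← Category.assoc, ← comp_whiskerRight,
      J.cup_comp_j_one, MonoidalLinear.smul_whiskerRight, Linear.smul_comp, smul_smul]
  · intro e _ hne
    rw [Linear.comp_smul, Junctions.treeL, ← Category.assoc, ← comp_whiskerRight,
      J.cup_comp_j_eq_zero hne.symm, MonoidalPreadditive.zero_whiskerRight, Limits.zero_comp,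
      smul_zero]
  · exact fun h => (h (Finset.mem_univ _)).elim

/-- Bending a junction can be undone. -/
lemma whiskerLeft_bend {C : Type u} [Category.{v} C] [MonoidalCategory C] {a a' M N : C}
    (p : 𝟙_ C ⟶ a ⊗ a') (q : a' ⊗ a ⟶ 𝟙_ C) (φ : a' ⊗ N ⟶ M) :
    a' ◁ bend p φ ≫ (α_ _ _ _).inv ≫ q ▷ M ≫ (λ_ M).hom = zag p q ▷ N ≫ φ := by
  have h : a' ◁ bend p φ ≫ (α_ _ _ _).inv ≫ q ▷ M ≫ (λ_ M).hom =
      a' ◁ ((λ_ N).inv ≫ p ▷ N ≫ (α_ a a' N).hom) ≫ (α_ _ _ _).inv ≫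
        (a' ⊗ a) ◁ φ ≫ q ▷ M ≫ (λ_ M).hom := by
    simp [bend]
  rw [h, whisker_exchange_assoc, leftUnitor_naturality]
  simp only [zag]
  monoidal

omit [MonoidalLinear ℂ C] in
-- Bending is invertible: the dagger of the first zigzag equation straightens the bent strand.
lemma Junctions.bend_cup_ne_zero (J : Junctions V) {n c d : Row m}
    {φ : V.X n ⊗ V.X c ⟶ V.X d} (hφ : φ ≠ 0) : bend (J.cup n) φ ≠ 0 := by
  intro h
  apply hφ
  have h1 := whiskerLeft_bend (J.cup n) (UnitaryStructure.dag (J.cup' n)) φ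
  have h2 : zag (J.cup n) (UnitaryStructure.dag (J.cup' n)) = 𝟙 _ := by
    have := congrArg UnitaryStructure.dag (J.zigzag n)
    rw [UnitaryStructure.dag_id] at this
    rw [← this]
    have h3 := dag_zig (J.cup' n) (UnitaryStructure.dag (J.cup n))
    rw [UnitaryStructure.dag_dag] at h3
    exact h3.symm
  rw [h2, h, id_whiskerRight, Category.id_comp] at h1
  rw [← h1]
  simp

omit [MonoidalPreadditive C] [MonoidalLinear ℂ C] in
-- By Schur's lemma only the component of `f` in the channel `c` can be nonzero, and composing with
-- the junction detects it.
lemma Junctions.comp_j_ne_zero (J : Junctions V) (hC : IsFusionCategory C) {a b c : Row m}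
    {f : V.X c ⟶ V.X a ⊗ V.X b} (hf : f ≠ 0) : f ≫ J.j a b c ≠ 0 := by
  intro h
  apply hf
  obtain ⟨p, -, -, hp⟩ := J.exists_dual_basis hC a b
  rw [← Category.comp_id f, ← hp, Preadditive.comp_sum]
  refine Finset.sum_eq_zero fun e _ => ?_
  by_cases he : c = e
  · subst he
    rw [← Category.assoc, h, Limits.zero_comp]
  · rw [← Category.assoc, V.hom_eq_zero he (f ≫ _), Limits.zero_comp]

/-- If the symbol vanished, so would the bubble `c ⟶ n ⊗ s ⟶ c` obtained by bending `j n c s` and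
closing with `j n s c`. The bent junction is nonzero, and a nonzero vector of `Hom(c, n ⊗ s)` is
detected by `j n s c`. -/
lemma Junctions.IsFSymbol.inv_ne_zero [DecidableEq (Row m)] {J : Junctions V}
    (hC : IsFusionCategory C) {F Finv : Row m → Row m → Row m → Row m → Row m → Row m → ℂ}
    (h : J.IsFSymbol F Finv) {n c s : Row m} (hs : Row.Fuses n c s ∧ Row.Fuses n s c) :
    Finv n n c c (Row.one hm) s ≠ 0 := by
  intro h0
  have h1 := h.cup_comp_treeR hC hs
  rw [h0, zero_mul, zero_smul] at h1
  apply J.comp_j_ne_zero hC (J.bend_cup_ne_zero (J.j_ne_zero _ _ _ hs.1))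
  have h2 : bend (J.cup n) (J.j n c s) ≫ J.j n s c =
      (λ_ _).inv ≫ J.cup n ▷ V.X c ≫ J.treeR n n c c s := by
    simp [bend, Junctions.treeR]
  rw [h2, h1, Limits.comp_zero]

omit [MonoidalPreadditive C] [MonoidalLinear ℂ C] in
-- Absorbing a trivial third leg before or after fusing the first two is the same, by naturality of
-- the right unitor.
lemma Junctions.tree_one (J : Junctions V) (n : Row m) :
    J.treeL n n (Row.one hm) (Row.one hm) (Row.one hm) =
      J.treeR n n (Row.one hm) (Row.one hm) n := by
  rw [Junctions.treeL, Junctions.treeR, J.j_one_right n, J.j_one_right (Row.one hm),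
    ← whisker_exchange_assoc, rightUnitor_naturality]
  simp

omit [MonoidalLinear ℂ C] in
lemma Junctions.IsFSymbol.inv_one [DecidableEq (Row m)] {J : Junctions V}
    (hC : IsFusionCategory C) {F Finv : Row m → Row m → Row m → Row m → Row m → Row m → ℂ}
    (h : J.IsFSymbol F Finv) (n : Row m) :
    Finv n n (Row.one hm) (Row.one hm) (Row.one hm) n = 1 := by
  have hf : Row.Fuses n (Row.one hm) n ∧ Row.Fuses n n (Row.one hm) :=
    ⟨(Row.fuses_mid_one hm n n).mpr rfl, (Row.fuses_one_right hm n n).mpr rfl⟩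
  have he : Row.Fuses n n (Row.one hm) ∧ Row.Fuses (Row.one hm) (Row.one hm) (Row.one hm) :=
    ⟨hf.2, (Row.fuses_mid_one hm _ _).mpr rfl⟩
  have h1 := h.move_inv hC hf
  rw [← J.tree_one] at h1
  have h2 := J.treeL_independent hC n n (Row.one hm) (Row.one hm)
    (fun e => Finv n n (Row.one hm) (Row.one hm) e n - if e = Row.one hm then 1 else 0) ?_ _ he
  · simpa [sub_eq_zero] using h2
  · simp only [sub_smul, Finset.sum_sub_distrib, ← h1, ite_smul, one_smul, zero_smul,
      Finset.sum_ite_eq', Finset.mem_univ, if_true, sub_self]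

end FSymbols

/-! ## Operators of lines -/

section Lines

variable {m : ℕ} {hm : 3 ≤ m} {C : Type u} [Category.{v} C] [Abelian C] [Linear ℂ C]
  [MonoidalCategory C] [MonoidalPreadditive C] [MonoidalLinear ℂ C] [UnitaryStructure C]
  {V : VerlindeLines m hm C}

omit [MonoidalLinear ℂ C] in
-- The resolution of `Y` is inserted at the right junction, and each projection `π i` slides to the
-- left end.
lemma SymmetricTheory.line_resolve (T : SymmetricTheory.{u, v, w} V) {a b c d : Row m} {Y : C}
    {k : ℕ} {e : Fin k → Row m} {π : ∀ i, Y ⟶ V.X (e i)} {ι : ∀ i, V.X (e i) ⟶ Y}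
    (h : ∑ i, π i ≫ ι i = 𝟙 Y) (l : V.X c ⟶ Y ⊗ V.X a) (g : Y ⊗ V.X b ⟶ V.X d) :
    T.line Y l g = ∑ i, T.line (V.X (e i)) (l ≫ π i ▷ V.X a) (ι i ▷ V.X b ≫ g) := by
  have hg : g = ∑ i, π i ▷ V.X b ≫ ι i ▷ V.X b ≫ g := by
    calc g = (∑ i, π i ≫ ι i) ▷ V.X b ≫ g := by rw [h, id_whiskerRight, Category.id_comp]
      _ = _ := by
        rw [sum_whiskerRight, Preadditive.sum_comp]
        exact Finset.sum_congr rfl fun i _ => by rw [comp_whiskerRight, Category.assoc]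
  conv_lhs => rw [hg, map_sum]
  exact Finset.sum_congr rfl fun i _ => T.line_slide _ _ _

omit [MonoidalPreadditive C] [MonoidalLinear ℂ C] in
-- Bending the pairing `n ⊗ n ⟶ 1` produces a zigzag, which straightens to the canonical isomorphism
-- `n ≅ n ⊗ 1`.
lemma Junctions.bend_up (J : Junctions V) (n : Row m) :
    bend (J.cup' n) (J.j n n (Row.one hm)) = (ρ_ (V.X n)).inv ≫ V.X n ◁ V.unit.inv := by
  have h : bend (J.cup' n) (J.j n n (Row.one hm)) =
      zig (J.cup' n) (UnitaryStructure.dag (J.cup n)) ≫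
        (ρ_ (V.X n)).inv ≫ V.X n ◁ V.unit.inv := by
    rw [J.j_dual]
    simp [bend, zig]
  rw [h, show zig (J.cup' n) (UnitaryStructure.dag (J.cup n)) = 𝟙 _ from J.zigzag n,
    Category.id_comp]

omit [MonoidalPreadditive C] [MonoidalLinear ℂ C] in
lemma SymmetricTheory.up_one_two (T : SymmetricTheory.{u, v, w} V) (J : Junctions V) :
    T.up J (Row.one hm) (Row.two hm) = ContinuousLinearMap.id ℂ _ := by
  have h : (ρ_ (V.X (Row.one hm))).inv ≫ V.X (Row.one hm) ◁ V.unit.inv ≫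
      V.unit.hom ▷ V.X (Row.one hm) = (λ_ _).inv := by
    rw [← cancel_mono (λ_ (V.X (Row.one hm))).hom, Category.assoc, Category.assoc,
      unit_iso_whisker]
    simp
  rw [SymmetricTheory.up, J.bend_up, J.j_one_left, T.line_slide, Category.assoc, h,
    T.line_unit]

lemma SymmetricTheory.down_comp_up [DecidableEq (Row m)] (T : SymmetricTheory.{u, v, w} V)
    {J : Junctions V} (hC : IsFusionCategory C)
    {F Finv : Row m → Row m → Row m → Row m → Row m → Row m → ℂ} (h : J.IsFSymbol F Finv)
    {n s : Row m} (hs : Row.Adj n s) :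
    (T.down J n s).comp (T.up J n s) =
      (Finv n n (Row.two hm) (Row.two hm) (Row.one hm) s * (J.dim n : ℂ)) •
        ContinuousLinearMap.id ℂ _ := by
  -- The combined left junction: the canonical isomorphisms `n ≅ n ⊗ 1` cancel, leaving only the cup
  -- beside the boundary `1`.
  have hl : bend (J.cup n) (J.j n (Row.one hm) n) ≫
      V.X n ◁ ((ρ_ (V.X n)).inv ≫ V.X n ◁ V.unit.inv) ≫ (α_ _ _ _).inv =
      (λ_ _).inv ≫ J.cup n ▷ V.X (Row.one hm) := by
    rw [J.j_one_right]
    have h1 : (V.X n ◁ V.unit.hom ≫ (ρ_ (V.X n)).hom) ≫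
        (ρ_ (V.X n)).inv ≫ V.X n ◁ V.unit.inv = 𝟙 _ := by simp
    simp only [bend, Category.assoc, ← MonoidalCategory.whiskerLeft_comp_assoc, h1]
    simp
  rw [SymmetricTheory.down, SymmetricTheory.up, J.bend_up, T.line_comp, hl,
    show (α_ _ _ _).hom ≫ V.X n ◁ J.j n (Row.two hm) s ≫ J.j n s (Row.two hm) =
      J.treeR n n (Row.two hm) (Row.two hm) s from rfl,
    h.move_inv hC ⟨(Row.fuses_two hm n s).mpr hs, (Row.fuses_to_two hm n s).mpr hs⟩, map_sum,
    Finset.sum_eq_single (Row.one hm)]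
  -- Identity channel: the vertex `n ⊗ n ⟶ 1` closes the cup to a loop, and the remaining unit line
  -- is transparent.
  · rw [map_smul, Junctions.treeL, T.line_slide, Category.assoc, ← comp_whiskerRight,
      J.cup_comp_j_one, MonoidalLinear.smul_whiskerRight, Linear.comp_smul, map_smul,
      LinearMap.smul_apply, smul_smul, J.j_one_left, T.line_slide, Category.assoc,
      ← comp_whiskerRight, V.unit.inv_hom_id, id_whiskerRight, Category.comp_id, T.line_unit]
  · intro e _ hne
    rw [map_smul, Junctions.treeL, T.line_slide, Category.assoc, ← comp_whiskerRight,
      J.cup_comp_j_eq_zero hne.symm, MonoidalPreadditive.zero_whiskerRight, Limits.comp_zero,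
      map_zero, LinearMap.zero_apply, smul_zero]
  · exact fun h => (h (Finset.mem_univ _)).elim

omit [MonoidalPreadditive C] [MonoidalLinear ℂ C] in
lemma SymmetricTheory.up_eq_zero (T : SymmetricTheory.{u, v, w} V) (J : Junctions V)
    (hC : IsFusionCategory C) {r s : Row m} (h : ¬ Row.Adj r s) : T.up J r s = 0 := by
  rw [SymmetricTheory.up, J.j_eq_zero hC (mt (Row.fuses_two hm r s).mp h), map_zero]

omit [MonoidalPreadditive C] [MonoidalLinear ℂ C] in
-- Since the left boundary is the unit, the left junction amounts to a morphism `r ⟶ e`, to which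
-- Schur's lemma applies. The right junction is a multiple of the basis vector.
lemma SymmetricTheory.exists_line_simple_eq (T : SymmetricTheory.{u, v, w} V) (J : Junctions V)
    (hC : IsFusionCategory C) {r s e : Row m} (l : V.X r ⟶ V.X e ⊗ V.X (Row.one hm))
    (g : V.X e ⊗ V.X (Row.two hm) ⟶ V.X s) :
    ∃ c : ℂ, T.line (V.X e) l g = c • T.up J r s := by
  have hl : l = (l ≫ V.X e ◁ V.unit.hom ≫ (ρ_ _).hom) ≫ (ρ_ _).inv ≫ V.X e ◁ V.unit.inv := by
    simp
  by_cases hr : r = e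
  · subst hr
    obtain ⟨x, hx⟩ := V.exists_smul_id hC (l ≫ V.X r ◁ V.unit.hom ≫ (ρ_ _).hom)
    obtain ⟨y, rfl⟩ := J.exists_eq_smul hC g
    rw [hx, Linear.smul_comp, Category.id_comp, ← J.bend_up] at hl
    refine ⟨y * x, ?_⟩
    rw [hl, map_smul, map_smul, LinearMap.smul_apply, smul_smul, SymmetricTheory.up]
  · refine ⟨0, ?_⟩
    rw [hl, V.hom_eq_zero hr (l ≫ _), Limits.zero_comp, map_zero, LinearMap.zero_apply,
      zero_smul]

omit [MonoidalLinear ℂ C] in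
lemma SymmetricTheory.exists_line_eq (T : SymmetricTheory.{u, v, w} V) (J : Junctions V)
    (hC : IsFusionCategory C) {r s : Row m} {Y : C} (l : V.X r ⟶ Y ⊗ V.X (Row.one hm))
    (g : Y ⊗ V.X (Row.two hm) ⟶ V.X s) : ∃ c : ℂ, T.line Y l g = c • T.up J r s := by
  obtain ⟨k, e, π, ι, h⟩ := V.exists_resolution hC Y
  choose c hc using fun i => T.exists_line_simple_eq J hC (l ≫ π i ▷ V.X (Row.one hm))
    (ι i ▷ V.X (Row.two hm) ≫ g)
  refine ⟨∑ i, c i, ?_⟩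
  rw [T.line_resolve h, Finset.sum_smul]
  exact Finset.sum_congr rfl fun i _ => hc i

end Lines

/-! ## Images of particles -/

section Images

variable {E E' : Type w} [NormedAddCommGroup E] [InnerProductSpace ℂ E] [NormedAddCommGroup E']
  [InnerProductSpace ℂ E']

/-- A bounded left inverse gives a lower bound on norms. This is stronger than injectivity and is
what keeps images of closed subspaces closed. -/
lemma antilipschitz_of_leftInverse {A : E →L[ℂ] E'} {B : E' →L[ℂ] E} {κ : ℂ} (hκ : κ ≠ 0)
    (h : B.comp A = κ • ContinuousLinearMap.id ℂ E) :
    AntilipschitzWith ‖κ⁻¹ • B‖₊ A := by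
  refine ContinuousLinearMap.antilipschitz_of_bound A fun x => ?_
  have hx : (κ⁻¹ • B) (A x) = x := by
    have := congrArg (fun f : E →L[ℂ] E => f x) h
    simp only [ContinuousLinearMap.comp_apply, _root_.smul_apply,
      ContinuousLinearMap.id_apply] at this
    rw [_root_.smul_apply, this, smul_smul, inv_mul_cancel₀ hκ, one_smul]
  calc ‖x‖ = ‖(κ⁻¹ • B) (A x)‖ := by rw [hx]
    _ ≤ _ := ContinuousLinearMap.le_opNorm _ _

variable [CompleteSpace E] [CompleteSpace E']

lemma PoincareRep.HasMass.map {U : PoincareRep E} {U' : PoincareRep E'} {A : E →L[ℂ] E'}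
    {k : NNReal} (hA : AntilipschitzWith k A)
    (ht : ∀ p ψ, A (U.trans p ψ) = U'.trans p (A ψ)) {μ : ℝ} {ψ : E} (h : U.HasMass μ ψ) :
    U'.HasMass μ (A ψ) := by
  intro f hf hf'
  -- The lower bound lets `A` pass through the integral without a separate integrability check.
  have h1 := ContinuousLinearMap.integral_comp_comm' (μ := MeasureTheory.volume) A hA
    fun p : ℝ × ℝ => ((kleinGordon μ f p : ℝ) : ℂ) • U.trans p ψ
  rw [h f hf hf', map_zero] at h1
  simpa only [map_smul, ht] using h1

/-- Being bounded below and equivariant, `A` is a closed embedding of representations. A closed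
invariant subspace of the image pulls back to one inside `K`, so irreducibility is inherited. -/
lemma PoincareRep.IsParticle.map {U : PoincareRep E} {U' : PoincareRep E'} {A : E →L[ℂ] E'}
    {k : NNReal} (hA : AntilipschitzWith k A)
    (ht : ∀ p ψ, A (U.trans p ψ) = U'.trans p (A ψ))
    (hb : ∀ θ ψ, A (U.boost θ ψ) = U'.boost θ (A ψ)) {μ : ℝ} {K : Submodule ℂ E}
    (h : U.IsParticle μ K) : U'.IsParticle μ (K.map A.toLinearMap) := by
  have hinj : Function.Injective A := hA.injective
  refine ⟨h.mass_pos, ?_, ⟨?_, ?_⟩, ?_, ?_, ?_⟩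
  · rw [Submodule.map_coe]
    exact (hA.isClosedEmbedding A.uniformContinuous).isClosedMap _ h.closed
  · rintro p _ ⟨ψ, hψ, rfl⟩
    exact ⟨U.trans p ψ, h.invariant.1 p ψ hψ, ht p ψ⟩
  · rintro θ _ ⟨ψ, hψ, rfl⟩
    exact ⟨U.boost θ ψ, h.invariant.2 θ ψ hψ, hb θ ψ⟩
  · exact fun h0 => h.ne_bot (Submodule.map_injective_of_injective hinj
      (h0.trans (Submodule.map_bot _).symm))
  · intro K' hcl hinv hle
    have hmap : (K'.comap A.toLinearMap).map A.toLinearMap = K' := by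
      refine Submodule.map_comap_eq_of_le (hle.trans ?_)
      exact LinearMap.map_le_range
    have hsub : K'.comap A.toLinearMap ≤ K := by
      intro ψ hψ
      obtain ⟨φ, hφ, hφψ⟩ := hle hψ
      exact hinj hφψ ▸ hφ
    have hcl' : IsClosed ((K'.comap A.toLinearMap : Submodule ℂ E) : Set E) :=
      hcl.preimage A.continuous
    have hinv' : U.Invariant (K'.comap A.toLinearMap) := by
      refine ⟨fun p ψ hψ => ?_, fun θ ψ hψ => ?_⟩
      · change A _ ∈ K'
        rw [ht]
        exact hinv.1 p _ hψ
      · change A _ ∈ K'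
        rw [hb]
        exact hinv.2 θ _ hψ
    rcases h.irreducible _ hcl' hinv' hsub with h' | h'
    · exact Or.inl (by rw [← hmap, h', Submodule.map_bot])
    · exact Or.inr (by rw [← hmap, h'])
  · rintro _ ⟨ψ, hψ, rfl⟩
    exact (h.mass ψ hψ).map hA ht

end Images

/-- The vectors lie in distinct summands, so each coefficient is read off from its own coordinate.
-/
lemma linearIndependent_piLp_single {ι κ : Type*} [Fintype ι] [DecidableEq ι] {E : ι → Type*}
    [∀ i, NormedAddCommGroup (E i)] [∀ i, InnerProductSpace ℂ (E i)] {f : κ → ι}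
    (hf : Function.Injective f) (v : ∀ k, E (f k)) (hv : ∀ k, v k ≠ 0) :
    LinearIndependent ℂ fun k => (PiLp.single 2 (f k) (v k) : PiLp 2 E) := by
  rw [linearIndependent_iff']
  intro s g hg k hk
  have h := congrArg (fun x : PiLp 2 E => x (f k)) hg
  simp only [PiLp.zero_apply] at h
  rw [WithLp.ofLp_sum, Finset.sum_apply, Finset.sum_eq_single k] at h
  · simp only [WithLp.ofLp_smul, Pi.smul_apply] at h
    refine (smul_eq_zero.mp h).resolve_right ?_
    simpa using hv k
  · intro k' _ hne
    have : f k ≠ f k' := fun h => hne (hf h).symm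
    simp [this]
  · exact fun h => (h hk).elim

/-! ## Counting, and the case `m = 4` -/

lemma Row.card_adj {m : ℕ} (hm : 3 ≤ m) :
    Nat.card {p : Row m × Row m // Row.Adj p.1 p.2} = 2 * (m - 2) := by
  -- Ascending pairs are `(i + 1, i + 2)` and descending ones `(i + 2, i + 1)`, each with `i < m -
  -- 2`.
  have e : {p : Row m × Row m // Row.Adj p.1 p.2} ≃ Fin (m - 2) ⊕ Fin (m - 2) :=
    { toFun := fun p => if h : p.1.2.1 = p.1.1.1 + 1
        then Sum.inl ⟨p.1.1.1 - 1, by have := p.1.1.2; have := p.1.2.2; omega⟩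
        else Sum.inr ⟨p.1.2.1 - 1, by
          have := p.1.1.2; have := p.1.2.2; have := p.2.resolve_left h; omega⟩
      invFun := Sum.elim
        (fun i => ⟨(⟨i.1 + 1, by omega, by omega⟩, ⟨i.1 + 2, by omega, by omega⟩), Or.inl rfl⟩)
        (fun i => ⟨(⟨i.1 + 2, by omega, by omega⟩, ⟨i.1 + 1, by omega, by omega⟩), Or.inr rfl⟩)
      left_inv := by
        rintro ⟨⟨⟨n, hn⟩, ⟨s, hs⟩⟩, h⟩
        obtain rfl | rfl : s = n + 1 ∨ s + 1 = n := h
        · obtain ⟨n, rfl⟩ := Nat.exists_eq_add_of_le' hn.1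
          simp
        · obtain ⟨s, rfl⟩ := Nat.exists_eq_add_of_le' hs.1
          simp
      right_inv := by
        rintro (⟨i, hi⟩ | ⟨i, hi⟩) <;> simp }
  rw [Nat.card_congr e, Nat.card_eq_fintype_card, Fintype.card_sum, Fintype.card_fin, two_mul]

section Tensor

variable {m : ℕ} {hm : 3 ≤ m} {C : Type u} [Category.{v} C] [Abelian C] [Linear ℂ C]
  [MonoidalCategory C] [UnitaryStructure C] {V : VerlindeLines m hm C}

/-- With a single fusion channel the resolution of the identity has one term, so the junction and
its dual vector are mutually inverse. -/
lemma Junctions.nonempty_iso_of_fuses_iff (J : Junctions V) (hC : IsFusionCategory C)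
    {a b c : Row m} (h : ∀ e, Row.Fuses a b e ↔ e = c) : Nonempty (V.X a ⊗ V.X b ≅ V.X c) := by
  obtain ⟨p, hp, -, hs⟩ := J.exists_dual_basis hC a b
  rw [Finset.sum_eq_single c] at hs
  · exact ⟨⟨J.j a b c, p c, hs, hp c ((h c).mpr rfl)⟩⟩
  · intro e _ hne
    rw [J.j_eq_zero hC (mt (h e).mp hne), Limits.zero_comp]
  · exact fun h => (h (Finset.mem_univ c)).elim

lemma Junctions.nonempty_iso_biprod_of_fuses_iff (J : Junctions V) (hC : IsFusionCategory C)
    {a b c d : Row m} (hcd : c ≠ d) (h : ∀ e, Row.Fuses a b e ↔ e = c ∨ e = d) :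
    Nonempty (V.X a ⊗ V.X b ≅ V.X c ⊞ V.X d) := by
  classical
  obtain ⟨p, hp, hp0, hs⟩ := J.exists_dual_basis hC a b
  rw [← Finset.sum_subset (Finset.subset_univ {c, d}), Finset.sum_pair hcd] at hs
  · refine ⟨⟨Limits.biprod.lift (J.j a b c) (J.j a b d), Limits.biprod.desc (p c) (p d), ?_, ?_⟩⟩
    · rw [Limits.biprod.lift_desc, hs]
    · ext
      · simp [hp c ((h c).mpr (Or.inl rfl))]
      · simp [hp0 c d hcd]
      · simp [hp0 d c hcd.symm]
      · simp [hp d ((h d).mpr (Or.inr rfl))]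
  · intro e _ he
    have : ¬ Row.Fuses a b e := by
      rw [h e]
      simpa using he
    rw [J.j_eq_zero hC this, Limits.zero_comp]

end Tensor

lemma SymmetricTheory.exists_down_comp_up_eq {m : ℕ} {hm : 3 ≤ m} {C : Type u} [Category.{v} C]
    [Abelian C] [Linear ℂ C] [MonoidalCategory C] [MonoidalPreadditive C] [MonoidalLinear ℂ C]
    [UnitaryStructure C] {V : VerlindeLines m hm C} (T : SymmetricTheory.{u, v, w} V)
    (J : Junctions V) (hC : IsFusionCategory C) {n s : Row m} (hs : Row.Adj n s) :
    ∃ κ : ℂ, κ ≠ 0 ∧ (T.down J n s).comp (T.up J n s) = κ • ContinuousLinearMap.id ℂ _ := by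
  classical
  obtain ⟨F, hF, -⟩ := J.existsUnique_isFSymbol hC
  refine ⟨_, ?_, T.down_comp_up hC hF hs⟩
  exact mul_ne_zero
    (hF.inv_ne_zero hC ⟨(Row.fuses_two hm n s).mpr hs, (Row.fuses_to_two hm n s).mpr hs⟩)
    (Complex.ofReal_ne_zero.mpr (J.dim_pos hC n).ne')

lemma SymmetricTheory.linearIndependent_single {m : ℕ} {hm : 3 ≤ m} {C : Type u} [Category.{v} C]
    [Abelian C] [Linear ℂ C] [MonoidalCategory C] [MonoidalPreadditive C] [MonoidalLinear ℂ C]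
    [UnitaryStructure C] {V : VerlindeLines m hm C} (T : SymmetricTheory.{u, v, w} V)
    [DecidableEq (Row m × Row m)] {P : Row m × Row m → Prop}
    {ψ : ∀ p : {p : Row m × Row m // P p}, T.H p.1.1 p.1.2} (hψ : ∀ p, ψ p ≠ 0) :
    LinearIndependent ℂ fun p => (PiLp.single 2 p.1 (ψ p) : T.Total) :=
  linearIndependent_piLp_single (E := fun p : Row m × Row m => T.H p.1 p.2)
    (f := fun p : {p : Row m × Row m // P p} => p.1) Subtype.val_injective ψ hψ

/-- The category of lines for `m = 4` has the fusion rules of a `ℤ/2` Tambara-Yamagami category,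
and the allowed pairs are the four ones containing the noninvertible line. -/
lemma VerlindeLines.tambaraYamagami {m : ℕ} {hm : 3 ≤ m} {C : Type u} [Category.{v} C]
    [Abelian C] [Linear ℂ C] [MonoidalCategory C] [UnitaryStructure C]
    {V : VerlindeLines m hm C} (J : Junctions V) (hC : IsFusionCategory C) (h4 : m = 4) :
    ∃ one N η : Row m, one.1 = 1 ∧ N.1 = 2 ∧ η.1 = 3 ∧
      Nonempty (V.X one ≅ 𝟙_ C) ∧
      Nonempty (V.X η ⊗ V.X η ≅ 𝟙_ C) ∧
      Nonempty (V.X η ⊗ V.X N ≅ V.X N) ∧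
      Nonempty (V.X N ⊗ V.X η ≅ V.X N) ∧
      Nonempty (V.X N ⊗ V.X N ≅ 𝟙_ C ⊞ V.X η) ∧
      {p : Row m × Row m | Row.Adj p.1 p.2} = {(one, N), (N, one), (N, η), (η, N)} := by
  subst h4
  let η : Row 4 := ⟨3, by omega, by omega⟩
  have hcases : ∀ e : Row 4, e = Row.one hm ∨ e = Row.two hm ∨ e = η := by
    rintro ⟨e, he⟩
    simp only [Row.one, Row.two, η, Subtype.mk.injEq]
    omega
  have hηη : ∀ e, Row.Fuses η η e ↔ e = Row.one hm := by
    intro e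
    rw [Row.fuses_iff, Subtype.ext_iff, Nat.odd_iff]
    have := e.2
    simp only [Row.one, η]
    omega
  have hηN : ∀ e, Row.Fuses η (Row.two hm) e ↔ e = Row.two hm := by
    intro e
    rw [Row.fuses_iff, Subtype.ext_iff, Nat.odd_iff]
    have := e.2
    simp only [Row.two, η]
    omega
  have hNη : ∀ e, Row.Fuses (Row.two hm) η e ↔ e = Row.two hm := by
    intro e
    rw [Row.fuses_iff, Subtype.ext_iff, Nat.odd_iff]
    have := e.2
    simp only [Row.two, η]
    omega
  have hNN : ∀ e, Row.Fuses (Row.two hm) (Row.two hm) e ↔ e = Row.one hm ∨ e = η := by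
    intro e
    rw [Row.fuses_iff, Subtype.ext_iff, Subtype.ext_iff, Nat.odd_iff]
    have := e.2
    simp only [Row.one, Row.two, η]
    omega
  have hne : Row.one hm ≠ η := by simp [Row.one, η]
  obtain ⟨φ⟩ := J.nonempty_iso_of_fuses_iff hC hηη
  obtain ⟨ψ⟩ := J.nonempty_iso_biprod_of_fuses_iff hC hne hNN
  refine ⟨Row.one hm, Row.two hm, η, rfl, rfl, rfl, ⟨V.unit⟩, ⟨φ ≪≫ V.unit⟩,
    J.nonempty_iso_of_fuses_iff hC hηN, J.nonempty_iso_of_fuses_iff hC hNη,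
    ⟨ψ ≪≫ Limits.biprod.mapIso V.unit (Iso.refl _)⟩, ?_⟩
  ext ⟨⟨n, hn⟩, ⟨s, hs⟩⟩
  simp only [Row.Adj, Row.one, Row.two, η, Set.mem_ofPred_eq, Set.mem_insert_iff,
    Set.mem_singleton_iff, Prod.mk.injEq, Subtype.mk.injEq]
  omega

open Classical in
theorem mainTheorem4 (m : ℕ) (hm : 3 ≤ m)
    (C : Type u) [Category.{v} C] [Abelian C] [Linear ℂ C] [MonoidalCategory C]
    [MonoidalPreadditive C] [MonoidalLinear ℂ C] [RigidCategory C] [UnitaryStructure C]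
    (hC : IsFusionCategory C) (V : VerlindeLines m hm C) (T : SymmetricTheory.{u, v, w} V) :
    Nonempty (Junctions V) ∧
    Nat.card {p : Row m × Row m // Row.Adj p.1 p.2} = 2 * (m - 2) ∧
    (∀ J : Junctions V,
      (∃! F : (Row m → Row m → Row m → Row m → Row m → Row m → ℂ) ×
          (Row m → Row m → Row m → Row m → Row m → Row m → ℂ), J.IsFSymbol F.1 F.2) ∧
      (∀ F Finv, J.IsFSymbol F Finv → ∀ n s : Row m, Row.Adj n s →
        Finv n n (Row.one hm) (Row.one hm) (Row.one hm) n ≠ 0 ∧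
        Finv n n (Row.two hm) (Row.two hm) (Row.one hm) s ≠ 0 ∧
        0 < J.dim n ∧
        (T.down J n s).comp (T.up J n s) =
          (Finv n n (Row.one hm) (Row.one hm) (Row.one hm) n *
            Finv n n (Row.two hm) (Row.two hm) (Row.one hm) s * (J.dim n : ℂ)) •
            ContinuousLinearMap.id ℂ (T.H (Row.one hm) (Row.two hm))) ∧
      (∀ n s : Row m, Row.Adj n s →
        Function.Injective (T.up J n s) ∧ Function.Surjective (T.down J n s)) ∧
      T.up J (Row.one hm) (Row.two hm) =
        ContinuousLinearMap.id ℂ (T.H (Row.one hm) (Row.two hm)) ∧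
      (∀ (r s : Row m) (Y : C) (l : V.X r ⟶ Y ⊗ V.X (Row.one hm))
        (g : Y ⊗ V.X (Row.two hm) ⟶ V.X s),
        (Row.Adj r s → ∃ c : ℂ, T.line Y l g = c • T.up J r s) ∧
        (¬ Row.Adj r s → T.line Y l g = 0)) ∧
      (∀ (μ : ℝ) (K : Submodule ℂ (T.H (Row.one hm) (Row.two hm))),
        (T.U (Row.one hm) (Row.two hm)).IsParticle μ K →
        (∀ n s : Row m, Row.Adj n s →
          (T.U n s).IsParticle μ (K.map (T.up J n s).toLinearMap)) ∧
        (∀ ψ ∈ K, ψ ≠ 0 →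
          (∀ n s : Row m, Row.Adj n s →
            T.up J n s ψ ≠ 0 ∧ (T.U n s).HasMass μ (T.up J n s ψ)) ∧
          LinearIndependent ℂ (fun p : {p : Row m × Row m // Row.Adj p.1 p.2} =>
            (PiLp.single 2 p.1 (T.up J p.1.1 p.1.2 ψ) : T.Total))))) ∧
    (m = 4 → ∃ one N η : Row m, one.1 = 1 ∧ N.1 = 2 ∧ η.1 = 3 ∧
      Nonempty (V.X one ≅ 𝟙_ C) ∧
      Nonempty (V.X η ⊗ V.X η ≅ 𝟙_ C) ∧
      Nonempty (V.X η ⊗ V.X N ≅ V.X N) ∧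
      Nonempty (V.X N ⊗ V.X η ≅ V.X N) ∧
      Nonempty (V.X N ⊗ V.X N ≅ 𝟙_ C ⊞ V.X η) ∧
      {p : Row m × Row m | Row.Adj p.1 p.2} = {(one, N), (N, one), (N, η), (η, N)} ∧
      Nat.card {p : Row m × Row m // Row.Adj p.1 p.2} = 4) := by
  obtain ⟨J₀⟩ := V.nonempty_junctions hC
  refine ⟨⟨J₀⟩, Row.card_adj hm, fun J => ?_, fun h4 => ?_⟩
  · have hinj : ∀ n s : Row m, Row.Adj n s → ∃ k, AntilipschitzWith k (T.up J n s) := by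
      intro n s hs
      obtain ⟨κ, hκ, h⟩ := T.exists_down_comp_up_eq J hC hs
      exact ⟨_, antilipschitz_of_leftInverse hκ h⟩
    refine ⟨J.existsUnique_isFSymbol hC, fun F Finv hF n s hs => ?_, fun n s hs => ?_,
      T.up_one_two J, fun r s Y l g => ?_, fun μ K hK => ⟨fun n s hs => ?_, fun ψ hψ hψ0 => ?_⟩⟩
    · have h1 := hF.inv_one hC n
      refine ⟨by rw [h1]; exact one_ne_zero, hF.inv_ne_zero hC
        ⟨(Row.fuses_two hm n s).mpr hs, (Row.fuses_to_two hm n s).mpr hs⟩, J.dim_pos hC n, ?_⟩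
      rw [h1, one_mul]
      exact T.down_comp_up hC hF hs
    · obtain ⟨κ, hκ, h⟩ := T.exists_down_comp_up_eq J hC hs
      refine ⟨(antilipschitz_of_leftInverse hκ h).injective, fun ψ => ?_⟩
      refine ⟨T.up J n s (κ⁻¹ • ψ), ?_⟩
      rw [← ContinuousLinearMap.comp_apply, h, _root_.smul_apply, ContinuousLinearMap.id_apply,
        smul_smul, mul_inv_cancel₀ hκ, one_smul]
    · obtain ⟨c, hc⟩ := T.exists_line_eq J hC l g
      -- The multiple-of-`up` statement holds for all `(r, s)`; off the allowed pairs `up` itself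
      -- vanishes because its right junction does.
      exact ⟨fun _ => ⟨c, hc⟩, fun h => by rw [hc, T.up_eq_zero J hC h, smul_zero]⟩
    · obtain ⟨k, hk⟩ := hinj n s hs
      exact hK.map hk (T.line_trans _ _ _) (T.line_boost _ _ _)
    · have h0 : ∀ n s : Row m, Row.Adj n s → T.up J n s ψ ≠ 0 := by
        intro n s hs
        obtain ⟨k, hk⟩ := hinj n s hs
        exact (map_ne_zero_iff _ hk.injective).mpr hψ0
      refine ⟨fun n s hs => ⟨h0 n s hs, ?_⟩, ?_⟩
      · obtain ⟨k, hk⟩ := hinj n s hs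
        exact (hK.mass ψ hψ).map hk (T.line_trans _ _ _)
      · exact T.linearIndependent_single fun p => h0 _ _ p.2
  · obtain ⟨one, N, η, h1, h2, h3, i1, i2, i3, i4, i5, h⟩ := VerlindeLines.tambaraYamagami J₀ hC h4
    refine ⟨one, N, η, h1, h2, h3, i1, i2, i3, i4, i5, h, ?_⟩
    rw [Row.card_adj hm, h4]
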